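/- All vector spaces and Lie algebras are over $\mathbb{C}$. Let $\hat{\mathfrak{sl}}_2=\mathfrak{sl}_2\otimes\mathbb{C}[t,t^{-1}]\oplus\mathbb{C}K$ be the affine Lie algebra, with $K$ central and $[x_m,y_n]=[x,y]_{m+n}+m\operatorname{tr}(xy)\,\delta_{m+n,0}K$ for $x_n=x\otimes t^n$, and let $e,h,f$ be the standard basis of $\mathfrak{sl}_2$. Let $\mathcal{L}=\bigoplus_{s\in\mathbb{Z}}\mathbb{C}L_s\oplus\mathbb{C}C$ be the Virasoro algebra, with $C$ central and $[L_m,L_n]=(m-n)L_{m+n}+\frac{m^3-m}{12}\delta_{m+n,0}C$. Let $k,c\in\mathbb{C}$, $\lambda,\mu\in\mathbb{C}\setminus\{0\}$ and $(a,b)\in\mathbb{C}^2\setminus\{(0,0)\}$. Let $N\subseteq\hat{\mathfrak{sl}}_2$ be the subalgebra spanned by $e_n,f_{n+1},h_{n+1}$ $(n\ge 0)$ and $K$, and let $\mathbb{C}v$ be the one-dimensional $N$-module with $e_0v=\lambda v$, $f_1v=\mu v$, $Kv=kv$ and $e_{n+1}v=f_{n+2}v=h_{n+1}v=0$ for $n\ge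 0$. The universal Whittaker module is $\operatorname{Wh}^k(\lambda,\mu)=U(\hat{\mathfrak{sl}}_2)\otimes_{U(N)}\mathbb{C}v$, with Whittaker vector $w=1\otimes v$. Let $N_{\mathcal{L}}=\bigoplus_{s\ge 1}\mathbb{C}L_s\oplus\mathbb{C}C\subseteq\mathcal{L}$, and let $\mathbb{C}u$ be the one-dimensional $N_{\mathcal{L}}$-module with $L_1u=au$, $L_2u=bu$, $Cu=cu$ and $L_su=0$ for $s\ge 3$. The universal Virasoro Whittaker module is $\operatorname{Wh}^c_{\mathrm{Vir}}(a,b)=U(\mathcal{L})\otimes_{U(N_{\mathcal{L}})}\mathbb{C}u$, with Whittaker vector $w'=1\otimes u$. Then the vectors $$\prod_{i=0}^\infty (e_{-i-1})^{k_{i+1}}(h_{-i})^{l_i}(f_{-i})^{m_i}\,w,$$ where $(k_i)_{i\ge 1}$, $(l_i)_{i\ge 0}$, $(m_i)_{i\ge 0}$ run over the finitely supported sequences in $\mathbb{Z}_{\ge 0}$ and the factors of the product are written from left to right with increasing $i$, form a basis of $\operatorname{Wh}^k(\lambda,\mu)$. The unique linear map $\varphi^+\colon\operatorname{Wh}^k(\lambda,\mu)\to\operatorname{Wh}^c_{\mathrm{Vir}}(a,b)$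 with $$\prod_{i=0}^\infty (e_{-i-1})^{k_{i+1}}(h_{-i})^{l_i}(f_{-i})^{m_i}\,w\;\longmapsto\;\prod_{i=0}^\infty (L_{-3i})^{l_i}(L_{-3i-1})^{m_i}(L_{-3(i+1)+1})^{k_{i+1}}\,w'$$ (that is, $e_{-i-1}\mapsto L_{-3(i+1)+1}$, $h_{-i}\mapsto L_{-3i}$, $f_{-i}\mapsto L_{-3i-1}$ for $i\ge 0$ and $w\mapsto w'$; the right-hand side is the ordered product $L_0^{l_0}L_{-1}^{m_0}L_{-2}^{k_1}L_{-3}^{l_1}L_{-4}^{m_1}L_{-5}^{k_2}\cdots w'$) is an isomorphism of vector spaces. -/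

import Mathlib

noncomputable section

namespace WhittakerIso

open scoped TensorProduct

attribute [local instance 100] LieRing.ofAssociativeRing

/-! ### Induced modules -/

section Induced

variable {g : Type*} [LieRing g] [LieAlgebra ℂ g] (H : LieSubalgebra ℂ g)
  {M : Type*} [AddCommGroup M] [Module ℂ M]

/-- The algebra homomorphism `U(H) → U(g)` induced by the inclusion `H ⊆ g`. -/
def envelopingIncl : UniversalEnvelopingAlgebra ℂ H →ₐ[ℂ] UniversalEnvelopingAlgebra ℂ g :=
  UniversalEnvelopingAlgebra.lift ℂ ((UniversalEnvelopingAlgebra.ι ℂ).comp H.incl)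

/-- The `U(g)`-submodule of `U(g) ⊗_ℂ M` generated by all `ub ⊗ v - u ⊗ bv` with `u ∈ U(g)`,
`b ∈ U(H)`, `v ∈ M`. -/
def inducedRelations (ρ : H →ₗ⁅ℂ⁆ Module.End ℂ M) :
    Submodule (UniversalEnvelopingAlgebra ℂ g) (UniversalEnvelopingAlgebra ℂ g ⊗[ℂ] M) :=
  Submodule.span _ {z | ∃ (u : UniversalEnvelopingAlgebra ℂ g)
    (b : UniversalEnvelopingAlgebra ℂ H) (v : M),
    z = (u * envelopingIncl H b) ⊗ₜ[ℂ] v -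
      u ⊗ₜ[ℂ] (UniversalEnvelopingAlgebra.lift ℂ ρ b v)}

/-- The induced module `U(g) ⊗_{U(H)} M` of a representation `ρ` of `H` on `M`, i.e. the tensor
product of the right `U(H)`-module `U(g)` and the left `U(H)`-module `M`. -/
abbrev InducedModule (ρ : H →ₗ⁅ℂ⁆ Module.End ℂ M) : Type _ :=
  (UniversalEnvelopingAlgebra ℂ g ⊗[ℂ] M) ⧸ inducedRelations H ρ

/-- The class of `u ⊗ v` in `U(g) ⊗_{U(H)} M`. -/
def InducedModule.tmul (ρ : H →ₗ⁅ℂ⁆ Module.End ℂ M) (u : UniversalEnvelopingAlgebra ℂ g) (v : M) :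
    InducedModule H ρ :=
  (inducedRelations H ρ).mkQ (u ⊗ₜ[ℂ] v)

/-- The one-dimensional representation on `ℂ` given by a character `χ`: `x` acts by `χ x`. -/
def charRep (χ : H →ₗ⁅ℂ⁆ ℂ) : H →ₗ⁅ℂ⁆ Module.End ℂ ℂ :=
  (Algebra.lmul ℂ ℂ).toLieHom.comp χ

end Induced

/-! ### Subalgebras given by a linear span, and their characters -/

section Span

variable {g : Type*} [LieRing g] [LieAlgebra ℂ g]

theorem lie_mem_of_span {S : Set g} {P : Submodule ℂ g} (hS : ∀ x ∈ S, ∀ y ∈ S, ⁅x, y⁆ ∈ P)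
    {x y : g} (hx : x ∈ Submodule.span ℂ S) (hy : y ∈ Submodule.span ℂ S) : ⁅x, y⁆ ∈ P := by
  induction hx using Submodule.span_induction with
  | zero => simp
  | add a b _ _ ha hb => rw [add_lie]; exact P.add_mem ha hb
  | smul c a _ ha => rw [smul_lie]; exact P.smul_mem c ha
  | mem a ha =>
    induction hy using Submodule.span_induction with
    | zero => simp
    | add b c _ _ hb hc => rw [lie_add]; exact P.add_mem hb hc
    | smul c b _ hb => rw [lie_smul]; exact P.smul_mem c hb
    | mem b hb => exact hS a ha b hb

/-- The linear span of a set as a Lie subalgebra, if brackets of elements of the set lie in it. -/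
def spanSubalgebra (S : Set g) (hS : ∀ x ∈ S, ∀ y ∈ S, ⁅x, y⁆ ∈ Submodule.span ℂ S) :
    LieSubalgebra ℂ g where
  __ := Submodule.span ℂ S
  lie_mem' hx hy := lie_mem_of_span hS hx hy

/-- The restriction to a subalgebra of a linear functional that vanishes on brackets, as a
character. -/
def restrictChar (H : LieSubalgebra ℂ g) (φ : g →ₗ[ℂ] ℂ)
    (hφ : ∀ x ∈ H, ∀ y ∈ H, φ ⁅x, y⁆ = 0) : H →ₗ⁅ℂ⁆ ℂ where
  toLinearMap := φ.comp H.toSubmodule.subtype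
  map_lie' {x y} := by
    rw [LieRing.of_associative_ring_bracket, mul_comm, sub_self]
    exact hφ x.1 x.2 y.1 y.2

end Span

/-! ### The affine Lie algebra of `sl₂` -/

/-- The Lie algebra `sl₂(ℂ)` of traceless matrices. -/
abbrev Sl2 := LieAlgebra.SpecialLinear.sl (Fin 2) ℂ

def sl2E : Sl2 := ⟨!![0, 1; 0, 0], by
  simp [LieAlgebra.SpecialLinear.sl, ← LieSubalgebra.mem_toSubmodule, Matrix.trace_fin_two]⟩
def sl2H : Sl2 := ⟨!![1, 0; 0, -1], by
  simp [LieAlgebra.SpecialLinear.sl, ← LieSubalgebra.mem_toSubmodule, Matrix.trace_fin_two]⟩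
def sl2F : Sl2 := ⟨!![0, 0; 1, 0], by
  simp [LieAlgebra.SpecialLinear.sl, ← LieSubalgebra.mem_toSubmodule, Matrix.trace_fin_two]⟩

theorem lie_HE : ⁅sl2H, sl2E⁆ = (2 : ℂ) • sl2E := by
  ext i j
  fin_cases i <;> fin_cases j <;>
    simp [sl2H, sl2E, LieRing.of_associative_ring_bracket, one_add_one_eq_two]

theorem lie_HF : ⁅sl2H, sl2F⁆ = (-2 : ℂ) • sl2F := by
  ext i j
  fin_cases i <;> fin_cases j <;>
    simp [sl2H, sl2F, LieRing.of_associative_ring_bracket]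
  norm_num

theorem lie_EF : ⁅sl2E, sl2F⁆ = sl2H := by
  ext i j
  fin_cases i <;> fin_cases j <;>
    simp [sl2H, sl2F, sl2E, LieRing.of_associative_ring_bracket]

/-- The form `-tr(xy)` on `sl₂`, the negative of the normalised invariant form `(x, y) = tr(xy)`. -/
def negForm : LinearMap.BilinForm ℂ Sl2 :=
  LinearMap.mk₂ ℂ (fun x y => -Matrix.trace (x.1 * y.1))
    (by intros; simp [add_mul]; ring) (by intros; simp)
    (by intros; simp [mul_add]; ring) (by intros; simp)

theorem negForm_symm : negForm.IsSymm := ⟨fun x y => by simp [negForm, Matrix.trace_mul_comm x.1]⟩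

theorem negForm_invariant : negForm.lieInvariant Sl2 := by
  intro x y z
  have := Matrix.trace_mul_cycle y.1 z.1 x.1
  simp only [negForm, LinearMap.mk₂_apply, LieSubalgebra.coe_bracket,
    LieRing.of_associative_ring_bracket, sub_mul, mul_sub, Matrix.trace_sub, Matrix.mul_assoc] at *
  rw [this]
  ring

/-- The cocycle `(x tᵐ, y tⁿ) ↦ m tr(xy) δ_{m+n,0}` on the loop algebra of `sl₂`. For a bilinear
form `Φ`, `twoCocycleOfBilinear` has the value `n Φ(x, y) δ_{m+n,0}`, whence the form `-tr(xy)`. -/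
def cocycle : LieModule.Cohomology.twoCocycle ℂ (LieAlgebra.loopAlgebra ℂ ℤ Sl2)
    (TrivialLieModule ℂ (LieAlgebra.loopAlgebra ℂ ℤ Sl2) ℂ) :=
  LieAlgebra.LoopAlgebra.twoCocycleOfBilinear ℂ ℤ Sl2 negForm negForm_invariant negForm_symm

/-- The affine Lie algebra `sl₂ ⊗ ℂ[t, t⁻¹] ⊕ ℂ K`. -/
abbrev AffineSl2 := LieAlgebra.ofTwoCocycle cocycle

/-- The linear identification of `sl₂ ⊗ ℂ[t, t⁻¹] ⊕ ℂ` with `AffineSl2`. -/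
def affOf : (LieAlgebra.loopAlgebra ℂ ℤ Sl2 × ℂ) ≃ₗ[ℂ] AffineSl2 where
  toFun p := LieAlgebra.ofProd cocycle (p.1, (TrivialLieModule.equiv ℂ _ ℂ).symm p.2)
  invFun x := (((LieAlgebra.ofProd cocycle).symm x).1,
    TrivialLieModule.equiv ℂ _ ℂ ((LieAlgebra.ofProd cocycle).symm x).2)
  map_add' _ _ := rfl
  map_smul' _ _ := rfl
  left_inv _ := rfl
  right_inv _ := rfl

theorem lie_affOf (x y : LieAlgebra.loopAlgebra ℂ ℤ Sl2 × ℂ) :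
    ⁅affOf x, affOf y⁆ = affOf (⁅x.1, y.1⁆,
      LieAlgebra.LoopAlgebra.residuePairing ℂ ℤ Sl2 negForm x.1 y.1) := by
  have hz (u : LieAlgebra.loopAlgebra ℂ ℤ Sl2)
      (v : TrivialLieModule ℂ (LieAlgebra.loopAlgebra ℂ ℤ Sl2) ℂ) : ⁅u, v⁆ = 0 :=
    trivial_lie_zero _ _ u v
  change LieAlgebra.ofProd cocycle (_, _ + _ - _) = LieAlgebra.ofProd cocycle (_, _)
  rw [hz, hz, add_zero, sub_zero]
  rfl

/-- The element `xₙ = x ⊗ tⁿ`. -/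
def loop (x : Sl2) (n : ℤ) : AffineSl2 := affOf (AddMonoidAlgebra.single n 1 ⊗ₜ[ℂ] x, 0)

/-- The central element `K`. -/
def affK : AffineSl2 := affOf (0, 1)

/-- `[xₘ, yₙ] = [x, y]ₘ₊ₙ + m tr(xy) δ_{m+n,0} K`. -/
theorem lie_loop (x y : Sl2) (m n : ℤ) :
    ⁅loop x m, loop y n⁆ = loop ⁅x, y⁆ (m + n) +
      (if m + n = 0 then (m : ℂ) * Matrix.trace (x.1 * y.1) else 0) • affK := by
  rw [loop, loop, lie_affOf, loop, affK, ← map_smul, ← map_add]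
  congr 1
  refine Prod.ext ?_ ?_
  · simp only [LieAlgebra.ExtendScalars.bracket_tmul, AddMonoidAlgebra.single_mul_single,
      mul_one, Prod.fst_add, Prod.smul_fst, smul_zero, add_zero]
  · simp only [LieAlgebra.LoopAlgebra.residuePairing_apply_apply,
      LieAlgebra.LoopAlgebra.toFinsupp_single_tmul, Finsupp.single_apply]
    rw [Finsupp.sum_single_index (by simp)]
    by_cases hmn : m + n = 0
    · obtain rfl : n = -m := by omega
      simp [negForm]
    · have : ¬ m = -n := by omega
      simp [hmn, this]

theorem lie_affK (x : AffineSl2) : ⁅x, affK⁆ = 0 := by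
  obtain ⟨x, rfl⟩ := affOf.surjective x
  rw [affK, lie_affOf]
  have h0 : ⁅x.1, (0 : LieAlgebra.loopAlgebra ℂ ℤ Sl2)⁆ = 0 := lie_zero x.1
  dsimp only
  rw [h0, map_zero]
  exact map_zero affOf

theorem loop_smul (c : ℂ) (x : Sl2) (n : ℤ) : loop (c • x) n = c • loop x n := by
  rw [loop, loop, ← map_smul, TensorProduct.tmul_smul, Prod.smul_mk, smul_zero]

theorem loop_zero (n : ℤ) : loop 0 n = 0 := by
  simpa using loop_smul 0 0 n

/-! ### The universal Whittaker module of affine `sl₂` -/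

/-- The spanning set `{eₙ, fₙ₊₁, hₙ₊₁, K | n ≥ 0}` of `N`. -/
def affGens : Set AffineSl2 :=
  {x | (∃ n : ℕ, x = loop sl2E n ∨ x = loop sl2F (n + 1) ∨ x = loop sl2H (n + 1)) ∨ x = affK}

/-- The linear functional sending `x` to
`lam * (coefficient of e₀) + mu * (coefficient of f₁) + k * (coefficient of K)`. -/
def affFunctional (k lam mu : ℂ) : AffineSl2 →ₗ[ℂ] ℂ where
  toFun x := lam * (LieAlgebra.LoopAlgebra.toFinsupp ℂ ℤ Sl2 (affOf.symm x).1 0).1 0 1 +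
    mu * (LieAlgebra.LoopAlgebra.toFinsupp ℂ ℤ Sl2 (affOf.symm x).1 1).1 1 0 +
    k * (affOf.symm x).2
  map_add' x y := by simp; ring
  map_smul' c x := by simp; ring

theorem affFunctional_loop (k lam mu : ℂ) (x : Sl2) (n : ℤ) :
    affFunctional k lam mu (loop x n) =
      lam * (if n = 0 then x.1 0 1 else 0) + mu * (if n = 1 then x.1 1 0 else 0) := by
  simp only [affFunctional, loop, LinearMap.coe_mk, AddHom.coe_mk, LinearEquiv.symm_apply_apply,
    LieAlgebra.LoopAlgebra.toFinsupp_single_tmul, Finsupp.single_apply, mul_zero, add_zero]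
  split_ifs <;> simp

theorem affFunctional_affK (k lam mu : ℂ) : affFunctional k lam mu affK = k := by
  simp [affFunctional, affK]

theorem affGens_lie (k lam mu : ℂ) : ∀ x ∈ affGens, ∀ y ∈ affGens,
    ⁅x, y⁆ ∈ Submodule.span ℂ affGens ⊓ LinearMap.ker (affFunctional k lam mu) := by
  have hE (m : ℤ) (hm : 1 ≤ m) : loop sl2E m ∈
      Submodule.span ℂ affGens ⊓ LinearMap.ker (affFunctional k lam mu) := by
    refine ⟨Submodule.subset_span (Or.inl ⟨m.toNat, Or.inl ?_⟩), ?_⟩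
    · congr; omega
    · have h1 : m ≠ 0 := by omega
      simp [affFunctional_loop, sl2E, h1]
  have hF (m : ℤ) (hm : 2 ≤ m) : loop sl2F m ∈
      Submodule.span ℂ affGens ⊓ LinearMap.ker (affFunctional k lam mu) := by
    refine ⟨Submodule.subset_span (Or.inl ⟨(m - 1).toNat, Or.inr (Or.inl ?_)⟩), ?_⟩
    · congr; omega
    · have h1 : m ≠ 1 := by omega
      simp [affFunctional_loop, sl2F, h1]
  have hH (m : ℤ) (hm : 1 ≤ m) : loop sl2H m ∈
      Submodule.span ℂ affGens ⊓ LinearMap.ker (affFunctional k lam mu) := by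
    refine ⟨Submodule.subset_span (Or.inl ⟨(m - 1).toNat, Or.inr (Or.inr ?_)⟩), ?_⟩
    · congr; omega
    · simp [affFunctional_loop, sl2H]
  have hEE : Matrix.trace (sl2E.1 * sl2E.1) = 0 := by simp [sl2E, Matrix.trace_fin_two]
  have hFF : Matrix.trace (sl2F.1 * sl2F.1) = 0 := by simp [sl2F, Matrix.trace_fin_two]
  have hEH : ⁅sl2E, sl2H⁆ = (-2 : ℂ) • sl2E := by rw [← lie_skew, lie_HE, neg_smul]
  have hFH : ⁅sl2F, sl2H⁆ = (2 : ℂ) • sl2F := by rw [← lie_skew, lie_HF, neg_smul, neg_neg]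
  have hFE : ⁅sl2F, sl2E⁆ = (-1 : ℂ) • sl2H := by rw [← lie_skew, lie_EF, neg_smul, one_smul]
  have key (x y : Sl2) (m n : ℤ) (hmn : m + n ≠ 0 ∨ Matrix.trace (x.1 * y.1) = 0) :
      ⁅loop x m, loop y n⁆ = loop ⁅x, y⁆ (m + n) := by
    rw [lie_loop]
    rcases hmn with hmn | hmn <;> simp [hmn]
  rintro x (⟨m, rfl | rfl | rfl⟩ | rfl) y (⟨n, rfl | rfl | rfl⟩ | rfl)
  all_goals first
    | (rw [lie_affK]; exact Submodule.zero_mem _)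
    | (rw [← lie_skew, lie_affK, neg_zero]; exact Submodule.zero_mem _)
    | (rw [key _ _ _ _ (Or.inr hEE), lie_self, loop_zero]; exact Submodule.zero_mem _)
    | (rw [key _ _ _ _ (Or.inl (by omega))]
       first
        | (rw [lie_self, loop_zero]; exact Submodule.zero_mem _)
        | (rw [lie_EF]; exact hH _ (by omega))
        | (rw [hFE, loop_smul]; exact Submodule.smul_mem _ _ (hH _ (by omega)))
        | (rw [lie_HE, loop_smul]; exact Submodule.smul_mem _ _ (hE _ (by omega)))
        | (rw [hEH, loop_smul]; exact Submodule.smul_mem _ _ (hE _ (by omega)))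
        | (rw [lie_HF, loop_smul]; exact Submodule.smul_mem _ _ (hF _ (by omega)))
        | (rw [hFH, loop_smul]; exact Submodule.smul_mem _ _ (hF _ (by omega))))

/-- The subalgebra `N = ⟨eₙ, fₙ₊₁, hₙ₊₁, K | n ≥ 0⟩_ℂ`. -/
def affN : LieSubalgebra ℂ AffineSl2 :=
  spanSubalgebra affGens fun x hx y hy => (affGens_lie 0 0 0 x hx y hy).1

/-- The character of `N` with `e₀ ↦ lam`, `f₁ ↦ mu`, `K ↦ k` and `eₙ₊₁, fₙ₊₂, hₙ₊₁ ↦ 0` for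
`n ≥ 0`. -/
def affChar (k lam mu : ℂ) : affN →ₗ⁅ℂ⁆ ℂ :=
  restrictChar affN (affFunctional k lam mu) fun _ hx _ hy =>
    (lie_mem_of_span (affGens_lie k lam mu) hx hy).2

/-- The universal Whittaker module of level `k` for affine `sl₂`. -/
abbrev WhAff (k lam mu : ℂ) : Type :=
  InducedModule affN (charRep affN (affChar k lam mu))

/-- The Whittaker vector `1 ⊗ v`. -/
def whAffVec (k lam mu : ℂ) : WhAff k lam mu := InducedModule.tmul affN _ 1 1

/-- The image of `xₙ` in the universal enveloping algebra. -/
def uLoop (x : Sl2) (n : ℤ) : UniversalEnvelopingAlgebra ℂ AffineSl2 :=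
  UniversalEnvelopingAlgebra.ι ℂ (loop x n)

/-- The vector `∏_{i ≥ 0} e_{-i-1}^{κ i} h_{-i}^{l i} f_{-i}^{m i} w`, where the factors are ordered
from left to right with increasing `i`. (Factors with `κ i = l i = m i = 0` are omitted.) -/
def affPBW (k lam mu : ℂ) (κ l m : ℕ →₀ ℕ) : WhAff k lam mu :=
  (((κ.support ∪ l.support ∪ m.support).sort (· ≤ ·)).map fun i : ℕ =>
    uLoop sl2E (-i - 1) ^ κ i * uLoop sl2H (-i) ^ l i * uLoop sl2F (-i) ^ m i).prod •
      whAffVec k lam mu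

/-! ### The Virasoro algebra -/

/-- The Virasoro algebra `⨁ₛ ℂ Lₛ ⊕ ℂ C`: the first component holds the coefficients of the `Lₛ`,
the second one that of `C`. -/
@[ext] structure Virasoro where
  wittPart : ℤ →₀ ℂ
  centralPart : ℂ

namespace Virasoro

def equivProd : Virasoro ≃ (ℤ →₀ ℂ) × ℂ where
  toFun x := (x.1, x.2)
  invFun p := ⟨p.1, p.2⟩

instance : AddCommGroup Virasoro := equivProd.addCommGroup
instance : Module ℂ Virasoro := equivProd.module ℂ

/-- `equivProd` as a linear equivalence. -/
def linearEquivProd : Virasoro ≃ₗ[ℂ] (ℤ →₀ ℂ) × ℂ where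
  __ := equivProd
  map_add' _ _ := rfl
  map_smul' _ _ := rfl

/-- The basis vector `Lₙ`. -/
def L (n : ℤ) : Virasoro := ⟨Finsupp.single n 1, 0⟩

/-- The central element `C`. -/
def C : Virasoro := ⟨0, 1⟩

/-- The bilinear map with `(Lₘ, Lₙ) ↦ (m - n) Lₘ₊ₙ + (m³ - m)/12 δ_{m+n,0} C` on Witt parts. -/
def bracketAux : (ℤ →₀ ℂ) →ₗ[ℂ] (ℤ →₀ ℂ) →ₗ[ℂ] Virasoro :=
  Finsupp.linearCombination ℂ fun m : ℤ => Finsupp.linearCombination ℂ fun n : ℤ =>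
    ((m : ℂ) - n) • L (m + n) + (if m + n = 0 then ((m : ℂ) ^ 3 - m) / 12 else 0) • C

theorem bracketAux_single (m n : ℤ) (a b : ℂ) :
    bracketAux (Finsupp.single m a) (Finsupp.single n b) = (a * b) • (((m : ℂ) - n) • L (m + n) +
      (if m + n = 0 then ((m : ℂ) ^ 3 - m) / 12 else 0) • C) := by
  rw [bracketAux, Finsupp.linearCombination_single, LinearMap.smul_apply,
    Finsupp.linearCombination_single, smul_smul]

theorem wittPart_add (x y : Virasoro) : (x + y).wittPart = x.wittPart + y.wittPart := rfl
theorem centralPart_add (x y : Virasoro) :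
    (x + y).centralPart = x.centralPart + y.centralPart := rfl
theorem wittPart_smul (c : ℂ) (x : Virasoro) : (c • x).wittPart = c • x.wittPart := rfl
theorem centralPart_smul (c : ℂ) (x : Virasoro) : (c • x).centralPart = c * x.centralPart := rfl
theorem wittPart_L (n : ℤ) : (L n).wittPart = Finsupp.single n 1 := rfl
theorem centralPart_L (n : ℤ) : (L n).centralPart = 0 := rfl
theorem wittPart_C : C.wittPart = 0 := rfl
theorem centralPart_C : C.centralPart = 1 := rfl

theorem bracketAux_skew (x y : ℤ →₀ ℂ) : bracketAux x y = -bracketAux y x := by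
  induction x using Finsupp.induction_linear with
  | zero => simp
  | add x x' h h' => rw [map_add, map_add, LinearMap.add_apply, h, h', neg_add]
  | single m a =>
    induction y using Finsupp.induction_linear with
    | zero => simp
    | add y y' h h' => rw [map_add, map_add, LinearMap.add_apply, h, h', neg_add]
    | single n b =>
      rw [bracketAux_single, bracketAux_single, add_comm n m]
      by_cases hmn : m + n = 0
      · obtain rfl : n = -m := by omega
        simp only [add_neg_cancel, if_true]
        push_cast
        module
      · simp only [hmn, if_false]
        module

theorem bracketAux_self (x : ℤ →₀ ℂ) : bracketAux x x = 0 := by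
  have h2 : (2 : ℂ) • bracketAux x x = 0 := by
    rw [two_smul]
    nth_rw 2 [bracketAux_skew]
    exact add_neg_cancel _
  simpa using h2

theorem bracketAux_leibniz (x y z : ℤ →₀ ℂ) :
    bracketAux x (bracketAux y z).wittPart =
      bracketAux (bracketAux x y).wittPart z + bracketAux y (bracketAux x z).wittPart := by
  induction x using Finsupp.induction_linear with
  | zero => simp [show (0 : Virasoro).wittPart = 0 from rfl]
  | add x x' h h' =>
    simp only [map_add, LinearMap.add_apply, wittPart_add, h, h']
    abel
  | single m a =>
  induction y using Finsupp.induction_linear with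
  | zero => simp [show (0 : Virasoro).wittPart = 0 from rfl]
  | add x x' h h' =>
    simp only [map_add, LinearMap.add_apply, wittPart_add, h, h']
    abel
  | single n b =>
  induction z using Finsupp.induction_linear with
  | zero => simp [show (0 : Virasoro).wittPart = 0 from rfl]
  | add x x' h h' =>
    simp only [map_add, wittPart_add, h, h']
    abel
  | single p c =>
    simp only [bracketAux_single, wittPart_add, wittPart_smul, wittPart_L, wittPart_C, smul_zero,
      add_zero, map_smul, LinearMap.smul_apply]
    rw [show n + (m + p) = m + (n + p) by ring, show m + n + p = m + (n + p) by ring]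
    by_cases h : m + (n + p) = 0
    · obtain rfl : p = -m - n := by omega
      simp only [h, if_true]
      push_cast
      module
    · simp only [h, if_false]
      push_cast
      module

instance : LieRing Virasoro where
  bracket x y := bracketAux x.wittPart y.wittPart
  add_lie x y z := by
    change bracketAux (x.wittPart + y.wittPart) _ = _
    rw [map_add]
    rfl
  lie_add x y z := map_add (bracketAux x.wittPart) _ _
  lie_self x := bracketAux_self _
  leibniz_lie x y z := bracketAux_leibniz _ _ _

instance : LieAlgebra ℂ Virasoro where
  lie_smul _ x _ := map_smul (bracketAux x.wittPart) _ _

/-- `[Lₘ, Lₙ] = (m - n) Lₘ₊ₙ + (m³ - m)/12 δ_{m+n,0} C`. -/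
theorem lie_L (m n : ℤ) : ⁅L m, L n⁆ = ((m : ℂ) - n) • L (m + n) +
    (if m + n = 0 then ((m : ℂ) ^ 3 - m) / 12 else 0) • C := by
  have := bracketAux_single m n 1 1
  rwa [one_mul, one_smul] at this

theorem lie_C (x : Virasoro) : ⁅x, C⁆ = 0 := map_zero (bracketAux x.wittPart)

end Virasoro

/-! ### The universal Virasoro Whittaker module -/

/-- The spanning set `{Lₛ, C | s ≥ 1}` of `N_𝓛`. -/
def virGens : Set Virasoro := {x | (∃ n : ℕ, x = Virasoro.L (n + 1)) ∨ x = Virasoro.C}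

/-- The linear functional sending `x` to
`a * (coefficient of L₁) + b * (coefficient of L₂) + c * (coefficient of C)`. -/
def virFunctional (c a b : ℂ) : Virasoro →ₗ[ℂ] ℂ where
  toFun x := a * x.wittPart 1 + b * x.wittPart 2 + c * x.centralPart
  map_add' x y := by
    simp only [Virasoro.wittPart_add, Virasoro.centralPart_add, Finsupp.add_apply]; ring
  map_smul' r x := by
    simp only [Virasoro.wittPart_smul, Virasoro.centralPart_smul, Finsupp.smul_apply, smul_eq_mul,
      RingHom.id_apply]
    ring

theorem virFunctional_L (c a b : ℂ) (n : ℤ) : virFunctional c a b (Virasoro.L n) =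
    a * (if n = 1 then 1 else 0) + b * (if n = 2 then 1 else 0) := by
  simp [virFunctional, Virasoro.wittPart_L, Virasoro.centralPart_L, Finsupp.single_apply]

theorem virFunctional_C (c a b : ℂ) : virFunctional c a b Virasoro.C = c := by
  simp [virFunctional, Virasoro.wittPart_C, Virasoro.centralPart_C]

theorem virGens_lie (c a b : ℂ) : ∀ x ∈ virGens, ∀ y ∈ virGens,
    ⁅x, y⁆ ∈ Submodule.span ℂ virGens ⊓ LinearMap.ker (virFunctional c a b) := by
  have hL (m : ℤ) (hm : 3 ≤ m) : Virasoro.L m ∈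
      Submodule.span ℂ virGens ⊓ LinearMap.ker (virFunctional c a b) := by
    refine ⟨Submodule.subset_span (Or.inl ⟨(m - 1).toNat, ?_⟩), ?_⟩
    · congr; omega
    · have h1 : m ≠ 1 := by omega
      have h2 : m ≠ 2 := by omega
      simp [virFunctional_L, h1, h2]
  rintro x (⟨m, rfl⟩ | rfl) y (⟨n, rfl⟩ | rfl)
  · by_cases hmn : m = n
    · rw [hmn, lie_self]; exact Submodule.zero_mem _
    · have h0 : ¬ ((m : ℤ) + 1 + (n + 1) = 0) := by omega
      rw [Virasoro.lie_L, if_neg h0, zero_smul, add_zero]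
      exact Submodule.smul_mem _ _ (hL _ (by omega))
  · rw [Virasoro.lie_C]; exact Submodule.zero_mem _
  · rw [← lie_skew, Virasoro.lie_C, neg_zero]; exact Submodule.zero_mem _
  · rw [Virasoro.lie_C]; exact Submodule.zero_mem _

/-- The subalgebra `N_𝓛 = ⨁_{s ≥ 1} ℂ Lₛ ⊕ ℂ C`. -/
def virN : LieSubalgebra ℂ Virasoro :=
  spanSubalgebra virGens fun x hx y hy => (virGens_lie 0 0 0 x hx y hy).1

/-- The character of `N_𝓛` with `L₁ ↦ a`, `L₂ ↦ b`, `C ↦ c` and `Lₛ ↦ 0` for `s ≥ 3`. -/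
def virChar (c a b : ℂ) : virN →ₗ⁅ℂ⁆ ℂ :=
  restrictChar virN (virFunctional c a b) fun _ hx _ hy =>
    (lie_mem_of_span (virGens_lie c a b) hx hy).2

/-- The universal Virasoro Whittaker module of central charge `c`. -/
abbrev WhVir (c a b : ℂ) : Type :=
  InducedModule virN (charRep virN (virChar c a b))

/-- The Whittaker vector `1 ⊗ u`. -/
def whVirVec (c a b : ℂ) : WhVir c a b := InducedModule.tmul virN _ 1 1

/-- The image of `Lₙ` in the universal enveloping algebra. -/
def uL (n : ℤ) : UniversalEnvelopingAlgebra ℂ Virasoro :=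
  UniversalEnvelopingAlgebra.ι ℂ (Virasoro.L n)

/-- The vector obtained from `affPBW` by the substitution `eᵢ ↦ L_{3i+1}`, `hᵢ ↦ L_{3i}`,
`fᵢ ↦ L_{3i-1}`, `w ↦ w`: with `k_{i+1} = κ i` it is
`∏_{i ≥ 0} L_{-3i}^{l i} L_{-3i-1}^{m i} L_{-3(i+1)+1}^{k_{i+1}} w`, with factors ordered from left
to right with increasing `i`; in other words the ordered product
`L₀^{l 0} L₋₁^{m 0} L₋₂^{κ 0} L₋₃^{l 1} L₋₄^{m 1} L₋₅^{κ 1} ⋯ w`. -/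
def virPBW (c a b : ℂ) (κ l m : ℕ →₀ ℕ) : WhVir c a b :=
  (((κ.support ∪ l.support ∪ m.support).sort (· ≤ ·)).map fun i : ℕ =>
    uL (-3 * i) ^ l i * uL (-3 * i - 1) ^ m i * uL (-3 * (i + 1) + 1) ^ κ i).prod •
      whVirVec c a b

end WhittakerIso

end

/-!
Let `H` be a subalgebra of a Lie algebra `g`, let `z` be an ordered basis of a complement of `H`,
and let `M` be a representation of `H`. Then `g` acts on the polynomials in `z` with coefficients
in `M`: a basis vector which comes before all variables of a monomial acts by multiplication, and
every other `x` is moved past the least variable by `x (z j t) = z j (x t) + ⁅x, z j⁆ t`, which is a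
recursion on the degree. This is a representation if the curvature `x y - y x - ⁅x, y⁆` vanishes. On
a monomial all of whose variables are at least `j`, this is the rule above if `y = z j`; and the
Bianchi identity for `x`, `y`, `z j` reduces the curvature on `z j t` to this case and to smaller
degrees. Acting on the constants is inverse to sending monomials to ordered products, so
`U(g) ⊗_{U(H)} M` is the space of polynomials.

The `e₋ᵢ₋₁`, `h₋ᵢ`, `f₋ᵢ` form a basis of a complement of `N`, and the `L₋ₙ`, `n ≥ 0`, of one of
`N_𝓛`. Both are indexed by `ℕ × {0, 1, 2}`, so the two Whittaker modules have bases indexed by the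
same exponents, and `φ⁺` matches these bases.
-/

noncomputable section

namespace WhittakerIso

open scoped TensorProduct

attribute [local instance 100] LieRing.ofAssociativeRing

/-! ### Polynomials and their degree filtration -/

section Polynomials

variable {R I M : Type*} [CommRing R] [AddCommGroup M] [Module R M]

variable (R I M) in
/-- The polynomials of degree at most `n` in variables indexed by `I` with coefficients in `M`. A
polynomial is encoded as a finitely supported function on monomials, a monomial as the multiset of
its variables. -/
def degLE (n : ℕ) : Submodule R (Multiset I →₀ M) :=
  Finsupp.supported M R {N | N.card ≤ n}

theorem single_mem_degLE {n : ℕ} {N : Multiset I} (hN : N.card ≤ n) (m : M) :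
    Finsupp.single N m ∈ degLE R I M n :=
  Finsupp.single_mem_supported R m hN

theorem degLE_mono {n n' : ℕ} (h : n ≤ n') : degLE R I M n ≤ degLE R I M n' :=
  Finsupp.supported_mono fun _ hN => le_trans hN h

theorem degLE_le {n : ℕ} {P : Submodule R (Multiset I →₀ M)}
    (h : ∀ N : Multiset I, N.card ≤ n → ∀ m, Finsupp.single N m ∈ P) : degLE R I M n ≤ P := by
  intro p hp
  rw [← Finsupp.sum_single p]
  exact sum_mem fun N hN => h N (hp hN) _

/-- Multiplication of polynomials with coefficients in `M` by a linear form. -/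
def linearMul : (I →₀ R) →ₗ[R] Module.End R (Multiset I →₀ M) :=
  Finsupp.linearCombination R fun i => Finsupp.lmapDomain M R (i ::ₘ ·)

theorem linearMul_single_single (i : I) (N : Multiset I) (m : M) :
    linearMul (Finsupp.single i (1 : R)) (Finsupp.single N m) = Finsupp.single (i ::ₘ N) m := by
  simp [linearMul]

theorem linearMul_mem_degLE (c : I →₀ R) {n : ℕ} {p : Multiset I →₀ M} (hp : p ∈ degLE R I M n) :
    linearMul c p ∈ degLE R I M (n + 1) := by
  refine degLE_le (P := (degLE R I M (n + 1)).comap (linearMul c)) (fun N hN m => ?_) hp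
  rw [Submodule.mem_comap, linearMul, Finsupp.linearCombination_apply, Finsupp.sum,
    LinearMap.sum_apply]
  refine sum_mem fun i _ => Submodule.smul_mem _ _ ?_
  rw [Finsupp.lmapDomain_apply, Finsupp.mapDomain_single]
  exact single_mem_degLE (by rw [Multiset.card_cons]; omega) m

end Polynomials

theorem eq_zero_or_exists_cons {I : Type*} [LinearOrder I] (N : Multiset I) :
    N = 0 ∨ ∃ j N', N = j ::ₘ N' ∧ ∀ a ∈ N', j ≤ a := by
  have hsorted := N.pairwise_sort (· ≤ ·)
  have hN := N.sort_eq (· ≤ ·)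
  cases hlist : N.sort (· ≤ ·) with
  | nil => exact .inl (by rw [← hN, hlist, Multiset.coe_nil])
  | cons j t =>
    rw [hlist] at hsorted hN
    exact .inr ⟨j, t, hN.symm, (List.pairwise_cons.1 hsorted).1⟩

/-- A complement of a Lie subalgebra `H` with ordered basis `z`, given by the coordinates modulo
`H` with respect to `z`. -/
structure OrderedComplement {R g : Type*} [CommRing R] [LieRing g] [LieAlgebra R g]
    (H : LieSubalgebra R g) (I : Type*) where
  z : I → g
  coord : g →ₗ[R] I →₀ R
  coord_z (i : I) : coord (z i) = Finsupp.single i 1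
  coord_eq_zero_iff {x : g} : coord x = 0 ↔ x ∈ H

namespace OrderedComplement

variable {R g I M : Type*} [CommRing R] [LieRing g] [LieAlgebra R g] {H : LieSubalgebra R g}
  (O : OrderedComplement H I)

theorem coord_linearCombination (c : I →₀ R) :
    O.coord (Finsupp.linearCombination R O.z c) = c := by
  simp [Finsupp.linearCombination_apply, map_finsuppSum, O.coord_z]

/-- The projection to `H` along the span of the `z i`. -/
def proj : g →ₗ[R] H :=
  (LinearMap.id - Finsupp.linearCombination R O.z ∘ₗ O.coord).codRestrict H.toSubmodule fun x =>
    O.coord_eq_zero_iff.1 (by simp [coord_linearCombination])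

theorem linearCombination_add_proj (x : g) :
    Finsupp.linearCombination R O.z (O.coord x) + O.proj x = x :=
  add_sub_cancel _ _

theorem proj_coe (x : H) : O.proj x = x := by
  have := O.linearCombination_add_proj x
  rw [O.coord_eq_zero_iff.2 x.2, map_zero, zero_add] at this
  exact Subtype.ext this

theorem linearMap_ext {V : Type*} [AddCommGroup V] [Module R V] {f f' : g →ₗ[R] V}
    (hz : ∀ i, f (O.z i) = f' (O.z i)) (hH : ∀ x ∈ H, f x = f' x) : f = f' := by
  ext x
  rw [← O.linearCombination_add_proj x, map_add, map_add, hH _ (O.proj x).2,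
    Finsupp.apply_linearCombination, Finsupp.apply_linearCombination,
    show f ∘ O.z = f' ∘ O.z from funext hz]

section After

variable [LinearOrder I]

/-- `x` is an element of `H`, or a basis vector `z i` which does not come before all variables of
the monomial `N`, so that `x` has to be moved past the least variable of `N`. -/
def After (N : Multiset I) (x : g) : Prop :=
  x ∈ H ∨ ∃ i, (∃ a ∈ N, a < i) ∧ x = O.z i

theorem after_zero {x : g} : O.After 0 x ↔ x ∈ H := by simp [After]

theorem after_cons {j : I} {N : Multiset I} (hj : ∀ a ∈ N, j ≤ a) {x : g} :
    O.After (j ::ₘ N) x ↔ x ∈ H ∨ ∃ i, j < i ∧ x = O.z i := by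
  have hlt (i : I) : (∃ a ∈ j ::ₘ N, a < i) ↔ j < i := by
    refine ⟨?_, fun h => ⟨j, Multiset.mem_cons_self j N, h⟩⟩
    rintro ⟨a, ha, hai⟩
    rcases Multiset.mem_cons.1 ha with rfl | ha
    exacts [hai, (hj a ha).trans_lt hai]
  simp only [After, hlt]

theorem linearMap_ext_after {V : Type*} [AddCommGroup V] [Module R V] (N : Multiset I)
    {f f' : g →ₗ[R] V} (hz : ∀ i, (∀ a ∈ N, i ≤ a) → f (O.z i) = f' (O.z i))
    (hafter : ∀ x, O.After N x → f x = f' x) : f = f' := by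
  refine O.linearMap_ext (fun i => ?_) fun x hx => hafter x (.inl hx)
  by_cases hi : ∀ a ∈ N, i ≤ a
  · exact hz i hi
  · push Not at hi
    exact hafter _ (.inr ⟨i, hi, rfl⟩)

/-- The linear projection which kills the `z i` that come before all variables of `N` and fixes
the elements after `N`. -/
def tail (N : Multiset I) : g →ₗ[R] g :=
  LinearMap.id -
    Finsupp.linearCombination R (fun i => if ∀ a ∈ N, i ≤ a then O.z i else 0) ∘ₗ O.coord

theorem tail_z_of_le {i : I} {N : Multiset I} (hi : ∀ a ∈ N, i ≤ a) : O.tail N (O.z i) = 0 := by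
  rw [tail, LinearMap.sub_apply, LinearMap.comp_apply, coord_z, Finsupp.linearCombination_single,
    if_pos hi, one_smul, LinearMap.id_apply, sub_self]

theorem tail_of_after {N : Multiset I} {x : g} (hx : O.After N x) : O.tail N x = x := by
  rw [tail, LinearMap.sub_apply, LinearMap.comp_apply, LinearMap.id_apply, sub_eq_self]
  rcases hx with hx | ⟨i, ⟨a, ha, hai⟩, rfl⟩
  · rw [O.coord_eq_zero_iff.2 hx, map_zero]
  · rw [coord_z, Finsupp.linearCombination_single, if_neg fun hi => (hi a ha).not_gt hai, smul_zero]

end After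

/-! ### The action on polynomials in the complement -/

section Action

variable [AddCommGroup M] [Module R M]

/-- The operators by which `g` acts on polynomials if `D N x m` is the part of degree at most that
of `N` of the image of the monomial `N` with coefficient `m` under `x`: the leading part is
multiplication by the linear form `coord x`. -/
def actOf (D : Multiset I → g →ₗ[R] M →ₗ[R] (Multiset I →₀ M)) :
    g →ₗ[R] Module.End R (Multiset I →₀ M) :=
  linearMul ∘ₗ O.coord + (Finsupp.lsum R).toLinearMap ∘ₗ LinearMap.pi D

variable {D D' : Multiset I → g →ₗ[R] M →ₗ[R] (Multiset I →₀ M)}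

theorem actOf_apply_single (x : g) (N : Multiset I) (m : M) :
    O.actOf D x (Finsupp.single N m) =
      linearMul (O.coord x) (Finsupp.single N m) + D N x m := by
  simp [actOf]

theorem actOf_congr {n : ℕ} (h : ∀ N : Multiset I, N.card ≤ n → D N = D' N) (x : g)
    {p : Multiset I →₀ M} (hp : p ∈ degLE R I M n) : O.actOf D x p = O.actOf D' x p := by
  refine degLE_le (P := LinearMap.eqLocus (O.actOf D x) (O.actOf D' x)) (fun N hN m => ?_) hp
  rw [LinearMap.mem_eqLocus, actOf_apply_single, actOf_apply_single, h N hN]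

theorem actOf_mem_degLE (hD : ∀ N x m, D N x m ∈ degLE R I M N.card) (x : g) {n : ℕ}
    {p : Multiset I →₀ M} (hp : p ∈ degLE R I M n) : O.actOf D x p ∈ degLE R I M (n + 1) := by
  refine degLE_le (P := (degLE R I M (n + 1)).comap (O.actOf D x)) (fun N hN m => ?_) hp
  rw [Submodule.mem_comap, actOf_apply_single]
  exact add_mem (linearMul_mem_degLE _ (single_mem_degLE hN m))
    (degLE_mono (by omega) (hD N x m))

variable (ρ : H →ₗ⁅R⁆ Module.End R M)

/-- The recursion for the part of lower degree of the action of an element `x` after the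
monomial `z j * t`: it comes from `x * (z j * t) = z j * (x * t) + ⁅x, z j⁆ * t`. -/
def lowerStep (D : Multiset I → g →ₗ[R] M →ₗ[R] (Multiset I →₀ M)) :
    List I → g →ₗ[R] M →ₗ[R] (Multiset I →₀ M)
  | [] => LinearMap.llcomp R _ _ _ (Finsupp.lsingle 0) ∘ₗ ρ.toLinearMap ∘ₗ O.proj
  | j :: t =>
      LinearMap.mk₂ R
        (fun x m => O.actOf D (O.z j) (D t x m) + O.actOf D ⁅x, O.z j⁆ (Finsupp.single t m))
        (fun x y m => by simp only [map_add, add_lie, LinearMap.add_apply]; abel)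
        (fun c x m => by simp only [map_smul, smul_lie, LinearMap.smul_apply, smul_add])
        (fun x m m' => by simp only [map_add, Finsupp.single_add]; abel)
        (fun c x m => by simp only [map_smul, ← Finsupp.smul_single, smul_add])

theorem lowerStep_mem_degLE {D : Multiset I → g →ₗ[R] M →ₗ[R] (Multiset I →₀ M)}
    (hD : ∀ N x m, D N x m ∈ degLE R I M N.card) (l : List I) (x : g) (m : M) :
    O.lowerStep ρ D l x m ∈ degLE R I M l.length := by
  cases l with
  | nil => exact single_mem_degLE (R := R) le_rfl _
  | cons j t =>
    exact add_mem (O.actOf_mem_degLE hD _ (hD t x m))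
      (O.actOf_mem_degLE hD _ (single_mem_degLE le_rfl m))

variable [LinearOrder I]

/-- The part of degree at most that of `N` of the action of `g` on the monomial `N`. -/
def lower (N : Multiset I) : g →ₗ[R] M →ₗ[R] (Multiset I →₀ M) :=
  O.lowerStep ρ (fun N' => if N'.card < N.card then lower N' else 0) (N.sort (· ≤ ·)) ∘ₗ O.tail N
termination_by N.card

/-- The action of `g` on polynomials in a complement of `H` which extends the representation `ρ`
of `H` on the coefficients. -/
def act : g →ₗ[R] Module.End R (Multiset I →₀ M) :=
  O.actOf (O.lower ρ)

theorem lower_mem_degLE (N : Multiset I) (x : g) (m : M) :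
    O.lower ρ N x m ∈ degLE R I M N.card := by
  induction hn : N.card using Nat.strong_induction_on generalizing N x m with
  | _ n ih =>
  subst hn
  have hD (N' : Multiset I) (y : g) (m' : M) :
      (if N'.card < N.card then O.lower ρ N' else 0) y m' ∈ degLE R I M N'.card := by
    split_ifs with hN'
    exacts [ih _ hN' N' y m' rfl, zero_mem _]
  rw [lower, LinearMap.comp_apply]
  simpa using O.lowerStep_mem_degLE ρ hD (N.sort (· ≤ ·)) (O.tail N x) m

theorem lower_zero_of_mem {x : g} (hx : x ∈ H) (m : M) :
    O.lower ρ 0 x m = Finsupp.single 0 (ρ ⟨x, hx⟩ m) := by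
  rw [lower, LinearMap.comp_apply, O.tail_of_after (O.after_zero.2 hx), Multiset.sort_zero,
    lowerStep]
  simp [O.proj_coe ⟨x, hx⟩]

theorem lower_cons {j : I} {N : Multiset I} (hj : ∀ a ∈ N, j ≤ a) {x : g}
    (hx : O.After (j ::ₘ N) x) (m : M) :
    O.lower ρ (j ::ₘ N) x m =
      O.act ρ (O.z j) (O.lower ρ N x m) + O.act ρ ⁅x, O.z j⁆ (Finsupp.single N m) := by
  have hD (N' : Multiset I) (hN' : N'.card ≤ N.card) :
      (if N'.card < (j ::ₘ N).card then O.lower ρ N' else 0) = O.lower ρ N' :=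
    if_pos (by rw [Multiset.card_cons]; omega)
  rw [lower, LinearMap.comp_apply, O.tail_of_after hx, Multiset.sort_cons j N (· ≤ ·) hj, lowerStep,
    LinearMap.mk₂_apply, Multiset.sort_eq, hD N le_rfl,
    O.actOf_congr hD (O.z j) (O.lower_mem_degLE ρ N x m),
    O.actOf_congr hD ⁅x, O.z j⁆ (single_mem_degLE le_rfl m), act]

theorem act_apply_single (x : g) (N : Multiset I) (m : M) :
    O.act ρ x (Finsupp.single N m) =
      linearMul (O.coord x) (Finsupp.single N m) + O.lower ρ N x m :=
  O.actOf_apply_single x N m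

theorem act_z_single {i : I} {N : Multiset I} (hi : ∀ a ∈ N, i ≤ a) (m : M) :
    O.act ρ (O.z i) (Finsupp.single N m) = Finsupp.single (i ::ₘ N) m := by
  rw [act_apply_single, coord_z, linearMul_single_single, lower, LinearMap.comp_apply,
    O.tail_z_of_le hi, map_zero, LinearMap.zero_apply, add_zero]

theorem act_single_zero {x : g} (hx : x ∈ H) (m : M) :
    O.act ρ x (Finsupp.single 0 m) = Finsupp.single 0 (ρ ⟨x, hx⟩ m) := by
  rw [act_apply_single, O.coord_eq_zero_iff.2 hx, map_zero, LinearMap.zero_apply, zero_add,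
    lower_zero_of_mem]

theorem act_single_cons {j : I} {N : Multiset I} (hj : ∀ a ∈ N, j ≤ a) {x : g}
    (hx : O.After (j ::ₘ N) x) (m : M) :
    O.act ρ x (Finsupp.single (j ::ₘ N) m) =
      O.act ρ (O.z j) (O.act ρ x (Finsupp.single N m)) +
        O.act ρ ⁅x, O.z j⁆ (Finsupp.single N m) := by
  have hleading : linearMul (O.coord x) (Finsupp.single (j ::ₘ N) m) =
      O.act ρ (O.z j) (linearMul (O.coord x) (Finsupp.single N m)) := by
    rcases (O.after_cons hj).1 hx with hx | ⟨i, hji, rfl⟩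
    · simp only [O.coord_eq_zero_iff.2 hx, map_zero, LinearMap.zero_apply]
    · have hji' : ∀ a ∈ i ::ₘ N, j ≤ a := Multiset.forall_mem_cons.2 ⟨hji.le, hj⟩
      rw [coord_z, linearMul_single_single, linearMul_single_single, O.act_z_single ρ hji',
        Multiset.cons_swap]
  rw [O.act_apply_single ρ x (j ::ₘ N), hleading, O.lower_cons ρ hj hx, O.act_apply_single ρ x N,
    map_add, add_assoc]

theorem act_single_mem_of_after {j : I} {N : Multiset I} (hj : ∀ a ∈ N, j ≤ a) {x : g}
    (hx : O.After (j ::ₘ N) x) (m : M) {P : Submodule R (Multiset I →₀ M)}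
    (hdeg : degLE R I M N.card ≤ P)
    (hle : ∀ N' : Multiset I, (∀ a ∈ N', j ≤ a) → Finsupp.single N' m ∈ P) :
    O.act ρ x (Finsupp.single N m) ∈ P := by
  rw [act_apply_single]
  refine add_mem ?_ (hdeg (O.lower_mem_degLE ρ N x m))
  rcases (O.after_cons hj).1 hx with hx | ⟨i, hji, rfl⟩
  · rw [O.coord_eq_zero_iff.2 hx, map_zero]
    exact zero_mem P
  · rw [coord_z, linearMul_single_single]
    exact hle _ (Multiset.forall_mem_cons.2 ⟨hji.le, hj⟩)

end Action

end OrderedComplement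

/-! ### Flatness of the action -/

section Curvature

variable {R g V : Type*} [CommRing R] [LieRing g] [LieAlgebra R g] [AddCommGroup V] [Module R V]
  (a : g →ₗ[R] Module.End R V)

/-- The failure of a family of operators `a` to be a representation of the Lie algebra `g`. -/
def curvature : g →ₗ[R] g →ₗ[R] Module.End R V :=
  LinearMap.mk₂ R (fun x y => a x * a y - a y * a x - a ⁅x, y⁆)
    (fun x x' y => by simp only [map_add, add_lie, add_mul, mul_add]; abel)
    (fun c x y => by simp only [map_smul, smul_lie, smul_mul_assoc, mul_smul_comm, smul_sub])
    (fun x y y' => by simp only [map_add, lie_add, add_mul, mul_add]; abel)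
    (fun c x y => by simp only [map_smul, lie_smul, smul_mul_assoc, mul_smul_comm, smul_sub])

theorem curvature_apply (x y : g) : curvature a x y = a x * a y - a y * a x - a ⁅x, y⁆ := rfl

theorem curvature_apply_apply (x y : g) (v : V) :
    curvature a x y v = a x (a y v) - a y (a x v) - a ⁅x, y⁆ v := rfl

theorem curvature_self (x : g) : curvature a x x = 0 := by
  rw [curvature_apply, lie_self, map_zero, sub_self, sub_zero]

theorem curvature_neg_flip (x y : g) : -curvature a y x = curvature a x y := by
  rw [curvature_apply, curvature_apply, ← lie_skew, map_neg]
  abel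

theorem curvature_eq_zero_symm {x y : g} {v : V} (h : curvature a y x v = 0) :
    curvature a x y v = 0 := by
  rw [← curvature_neg_flip, LinearMap.neg_apply, h, neg_zero]

theorem bianchi_identity (x y z : g) :
    (⁅a x, curvature a y z⁆ + curvature a x ⁅y, z⁆) +
      (⁅a y, curvature a z x⁆ + curvature a y ⁅z, x⁆) +
      (⁅a z, curvature a x y⁆ + curvature a z ⁅x, y⁆) = 0 := by
  have jacobi : a ⁅x, ⁅y, z⁆⁆ + a ⁅y, ⁅z, x⁆⁆ + a ⁅z, ⁅x, y⁆⁆ = 0 := by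
    rw [← map_add, ← map_add, lie_jacobi, map_zero]
  simp only [LieRing.of_associative_ring_bracket, curvature_apply]
  rw [← neg_eq_zero, ← jacobi]
  noncomm_ring

end Curvature

namespace OrderedComplement

variable {R g I M : Type*} [CommRing R] [LieRing g] [LieAlgebra R g] {H : LieSubalgebra R g}
  (O : OrderedComplement H I) [LinearOrder I] [AddCommGroup M] [Module R M]
  (ρ : H →ₗ⁅R⁆ Module.End R M)

theorem curvature_act_z_of_le {j : I} {N : Multiset I} (hj : ∀ a ∈ N, j ≤ a) (x : g) (m : M) :
    curvature (O.act ρ) x (O.z j) (Finsupp.single N m) = 0 := by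
  have hafter {k : I} (hk : ∀ a ∈ N, k ≤ a) {y : g} (hy : O.After (k ::ₘ N) y) :
      curvature (O.act ρ) y (O.z k) (Finsupp.single N m) = 0 := by
    rw [curvature_apply_apply, O.act_z_single ρ hk, O.act_single_cons ρ hk hy, add_sub_cancel_left,
      sub_self]
  suffices LinearMap.applyₗ (Finsupp.single N m) ∘ₗ (curvature (O.act ρ)).flip (O.z j) = 0 from
    LinearMap.congr_fun this x
  refine O.linearMap_ext_after (j ::ₘ N) (fun i hi => ?_) fun y hy => hafter hj hy
  obtain ⟨hij, hi⟩ := Multiset.forall_mem_cons.1 hi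
  rcases hij.lt_or_eq with hij | rfl
  · exact curvature_eq_zero_symm _ (hafter hi ((O.after_cons hi).2 (.inr ⟨j, hij, rfl⟩)))
  · exact LinearMap.congr_fun (curvature_self _ _) _

theorem curvature_act_of_after {N : Multiset I} {m : M}
    (h : ∀ x y, O.After N x → O.After N y → curvature (O.act ρ) x y (Finsupp.single N m) = 0)
    (x y : g) : curvature (O.act ρ) x y (Finsupp.single N m) = 0 := by
  suffices (curvature (O.act ρ)).compr₂ (LinearMap.applyₗ (Finsupp.single N m)) = 0 from
    LinearMap.congr_fun₂ this x y
  refine O.linearMap_ext_after N (fun i hi => ?_) fun x hx => ?_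
  · refine LinearMap.ext fun y => ?_
    exact curvature_eq_zero_symm _ (O.curvature_act_z_of_le ρ hi y m)
  · exact O.linearMap_ext_after N (fun i hi => O.curvature_act_z_of_le ρ hi x m)
      fun y hy => h x y hx hy

theorem curvature_act_zero {x y : g} (hx : x ∈ H) (hy : y ∈ H) (m : M) :
    curvature (O.act ρ) x y (Finsupp.single 0 m) = 0 := by
  have hρ : ρ ⟨⁅x, y⁆, H.lie_mem hx hy⟩ m = ρ ⟨x, hx⟩ (ρ ⟨y, hy⟩ m) - ρ ⟨y, hy⟩ (ρ ⟨x, hx⟩ m) :=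
    LinearMap.congr_fun (ρ.map_lie ⟨x, hx⟩ ⟨y, hy⟩) m
  rw [curvature_apply_apply, O.act_single_zero ρ (H.lie_mem hx hy), hρ]
  simp only [O.act_single_zero ρ hx, O.act_single_zero ρ hy, Finsupp.single_sub, sub_self]

theorem curvature_act_cons {k : I} {N : Multiset I} (hk : ∀ a ∈ N, k ≤ a)
    (hflat : ∀ x y, ∀ p ∈ degLE R I M N.card, curvature (O.act ρ) x y p = 0) {x y : g}
    (hx : O.After (k ::ₘ N) x) (hy : O.After (k ::ₘ N) y) (m : M) :
    curvature (O.act ρ) x y (Finsupp.single (k ::ₘ N) m) = 0 := by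
  have hk_act {x' : g} (hx' : O.After (k ::ₘ N) x') (y' : g) :
      curvature (O.act ρ) y' (O.z k) (O.act ρ x' (Finsupp.single N m)) = 0 :=
    O.act_single_mem_of_after ρ hk hx' m (P := LinearMap.ker (curvature (O.act ρ) y' (O.z k)))
      (fun p hp => hflat _ _ p hp) fun N' hN' => O.curvature_act_z_of_le ρ hN' y' m
  have hN (x' y' : g) : curvature (O.act ρ) x' y' (Finsupp.single N m) = 0 :=
    hflat x' y' _ (single_mem_degLE le_rfl m)
  have bianchi := LinearMap.congr_fun (bianchi_identity (O.act ρ) x y (O.z k)) (Finsupp.single N m)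
  simpa only [LieRing.of_associative_ring_bracket, LinearMap.add_apply, LinearMap.sub_apply,
    Module.End.mul_apply, LinearMap.zero_apply, hN, map_zero, hk_act hx,
    curvature_eq_zero_symm _ (hk_act hy x), O.act_z_single ρ hk, sub_zero, zero_sub, add_zero,
    zero_add, neg_eq_zero] using bianchi

theorem curvature_act_single (N : Multiset I) (x y : g) (m : M) :
    curvature (O.act ρ) x y (Finsupp.single N m) = 0 := by
  induction hn : N.card using Nat.strong_induction_on generalizing N x y m with
  | _ n ih =>
  refine O.curvature_act_of_after ρ (fun x y hx hy => ?_) x y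
  rcases eq_zero_or_exists_cons N with rfl | ⟨k, N, rfl, hk⟩
  · exact O.curvature_act_zero ρ (O.after_zero.1 hx) (O.after_zero.1 hy) m
  · refine O.curvature_act_cons ρ hk (fun x y => ?_) hx hy m
    refine degLE_le (P := LinearMap.ker (curvature (O.act ρ) x y)) fun N' hN' m' => ?_
    exact ih _ (by rw [← hn, Multiset.card_cons]; omega) N' x y m' rfl

/-- The representation of `g` on polynomials in a complement of `H` which extends the
representation `ρ` of `H` on the coefficients. -/
def rep : g →ₗ⁅R⁆ Module.End R (Multiset I →₀ M) where
  toLinearMap := O.act ρ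
  map_lie' {x y} := by
    refine Finsupp.lhom_ext fun N m => ?_
    exact (sub_eq_zero.1 (O.curvature_act_single ρ N x y m)).symm

theorem rep_apply (x : g) : O.rep ρ x = O.act ρ x := rfl

end OrderedComplement

/-! ### Induced modules -/

section Enveloping

variable {R g V W : Type*} [CommRing R] [LieRing g] [LieAlgebra R g] [AddCommGroup V] [Module R V]
  [AddCommGroup W] [Module R W]

theorem enveloping_induction {p : UniversalEnvelopingAlgebra R g → Prop}
    (algebraMap : ∀ r : R, p (algebraMap R _ r))
    (ι : ∀ x, p (UniversalEnvelopingAlgebra.ι R x))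
    (mul : ∀ u v, p u → p v → p (u * v)) (add : ∀ u v, p u → p v → p (u + v))
    (u : UniversalEnvelopingAlgebra R g) : p u := by
  obtain ⟨t, rfl⟩ : ∃ t, UniversalEnvelopingAlgebra.mkAlgHom R g t = u :=
    RingCon.mkₐ_surjective _ u
  induction t using TensorAlgebra.induction with
  | algebraMap r => rw [AlgHom.commutes]; exact algebraMap r
  | ι x => exact ι x
  | mul s t hs ht => rw [map_mul]; exact mul _ _ hs ht
  | add s t hs ht => rw [map_add]; exact add _ _ hs ht

theorem enveloping_intertwines {A : UniversalEnvelopingAlgebra R g →ₐ[R] Module.End R V}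
    {B : UniversalEnvelopingAlgebra R g →ₐ[R] Module.End R W} {f : V →ₗ[R] W}
    (h : ∀ x v, f (A (UniversalEnvelopingAlgebra.ι R x) v) =
      B (UniversalEnvelopingAlgebra.ι R x) (f v))
    (u : UniversalEnvelopingAlgebra R g) (v : V) : f (A u v) = B u (f v) := by
  induction u using enveloping_induction generalizing v with
  | algebraMap r => simp
  | ι x => exact h x v
  | mul u u' hu hu' => simp only [map_mul, Module.End.mul_apply, hu, hu']
  | add u u' hu hu' => simp only [map_add, LinearMap.add_apply, hu, hu']

end Enveloping

namespace InducedModule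

variable {g : Type*} [LieRing g] [LieAlgebra ℂ g] {H : LieSubalgebra ℂ g}
  {M V : Type*} [AddCommGroup M] [Module ℂ M] [AddCommGroup V] [Module ℂ V]
  {ρ : H →ₗ⁅ℂ⁆ Module.End ℂ M}

theorem smul_tmul (u u' : UniversalEnvelopingAlgebra ℂ g) (m : M) :
    u • tmul H ρ u' m = tmul H ρ (u * u') m :=
  rfl

theorem tmul_one_ι (h : H) (m : M) :
    tmul H ρ (UniversalEnvelopingAlgebra.ι ℂ (h : g)) m = tmul H ρ 1 (ρ h m) := by
  have hrel : (1 * envelopingIncl H (UniversalEnvelopingAlgebra.ι ℂ h)) ⊗ₜ[ℂ] m -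
      1 ⊗ₜ[ℂ] (UniversalEnvelopingAlgebra.lift ℂ ρ (UniversalEnvelopingAlgebra.ι ℂ h) m) ∈
      inducedRelations H ρ :=
    Submodule.subset_span ⟨1, _, m, rfl⟩
  rw [one_mul, envelopingIncl, UniversalEnvelopingAlgebra.lift_ι_apply,
    UniversalEnvelopingAlgebra.lift_ι_apply] at hrel
  exact (Submodule.Quotient.eq _).2 hrel

theorem linearMap_ext {f f' : InducedModule H ρ →ₗ[ℂ] V}
    (h : ∀ u m, f (tmul H ρ u m) = f' (tmul H ρ u m)) : f = f' := by
  let π : UniversalEnvelopingAlgebra ℂ g ⊗[ℂ] M →ₗ[ℂ] InducedModule H ρ :=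
    (inducedRelations H ρ).mkQ.restrictScalars ℂ
  have hπ : f ∘ₗ π = f' ∘ₗ π := TensorProduct.ext' h
  refine LinearMap.ext fun v => ?_
  obtain ⟨t, rfl⟩ := Submodule.mkQ_surjective _ v
  exact LinearMap.congr_fun hπ t

section Lift

variable (τ : g →ₗ⁅ℂ⁆ Module.End ℂ V) (f : M →ₗ[ℂ] V)

/-- The linear map `U(g) ⊗_ℂ M → V`, `u ⊗ m ↦ u (f m)`, for a representation of `g` on `V`. -/
def tensorLift : UniversalEnvelopingAlgebra ℂ g ⊗[ℂ] M →ₗ[ℂ] V :=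
  TensorProduct.lift
    (LinearMap.lcomp ℂ V f ∘ₗ (UniversalEnvelopingAlgebra.lift ℂ τ).toLinearMap)

theorem tensorLift_smul (u : UniversalEnvelopingAlgebra ℂ g)
    (t : UniversalEnvelopingAlgebra ℂ g ⊗[ℂ] M) :
    tensorLift τ f (u • t) = UniversalEnvelopingAlgebra.lift ℂ τ u (tensorLift τ f t) := by
  induction t using TensorProduct.induction_on with
  | zero => simp only [smul_zero, map_zero]
  | tmul u' m =>
    rw [TensorProduct.smul_tmul', smul_eq_mul]
    simp [tensorLift]
  | add s t hs ht => rw [smul_add, map_add, map_add, map_add, hs, ht]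

variable {f}

theorem tensorLift_eq_zero (hf : ∀ h m, f (ρ h m) = τ h (f m))
    {t : UniversalEnvelopingAlgebra ℂ g ⊗[ℂ] M} (ht : t ∈ inducedRelations H ρ) :
    tensorLift τ f t = 0 := by
  induction ht using Submodule.span_induction with
  | zero => exact map_zero _
  | add s t _ _ hs ht => rw [map_add, hs, ht, add_zero]
  | smul u t _ ht => rw [tensorLift_smul, ht, map_zero]
  | mem t ht =>
    obtain ⟨u, b, m, rfl⟩ := ht
    have hb : f (UniversalEnvelopingAlgebra.lift ℂ ρ b m) =
        UniversalEnvelopingAlgebra.lift ℂ τ (envelopingIncl H b) (f m) :=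
      enveloping_intertwines (B := (UniversalEnvelopingAlgebra.lift ℂ τ).comp (envelopingIncl H))
        (fun h m => by simpa [envelopingIncl] using hf h m) b m
    simp [tensorLift, hb]

/-- Frobenius reciprocity: the linear map `U(g) ⊗_{U(H)} M → V`, `u ⊗ m ↦ u (f m)`, for an
`H`-equivariant map `f` from `M` to a representation of `g`. -/
def lift (hf : ∀ h m, f (ρ h m) = τ h (f m)) : InducedModule H ρ →ₗ[ℂ] V :=
  ((inducedRelations H ρ).restrictScalars ℂ).liftQ (tensorLift τ f)
      (fun _ ht => tensorLift_eq_zero τ hf ht) ∘ₗ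
    (Submodule.Quotient.restrictScalarsEquiv ℂ (inducedRelations H ρ)).symm.toLinearMap

theorem lift_tmul (hf : ∀ h m, f (ρ h m) = τ h (f m)) (u : UniversalEnvelopingAlgebra ℂ g)
    (m : M) : lift τ hf (tmul H ρ u m) = UniversalEnvelopingAlgebra.lift ℂ τ u (f m) := rfl

end Lift

end InducedModule

/-! ### The Poincaré–Birkhoff–Witt theorem for induced modules -/

namespace OrderedComplement

section Monomial

variable {R g I : Type*} [CommRing R] [LieRing g] [LieAlgebra R g] {H : LieSubalgebra R g}
  (O : OrderedComplement H I) [LinearOrder I]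

/-- The ordered product of the basis vectors `z i` over a multiset of indices. -/
def monomial (N : Multiset I) : UniversalEnvelopingAlgebra R g :=
  ((N.sort (· ≤ ·)).map fun i => UniversalEnvelopingAlgebra.ι R (O.z i)).prod

theorem monomial_zero : O.monomial 0 = 1 := by
  rw [monomial, Multiset.sort_zero, List.map_nil, List.prod_nil]

theorem monomial_cons {i : I} {N : Multiset I} (hi : ∀ a ∈ N, i ≤ a) :
    O.monomial (i ::ₘ N) = UniversalEnvelopingAlgebra.ι R (O.z i) * O.monomial N := by
  rw [monomial, Multiset.sort_cons i N (· ≤ ·) hi, List.map_cons, List.prod_cons, monomial]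

theorem lift_rep_monomial {M : Type*} [AddCommGroup M] [Module R M] (ρ : H →ₗ⁅R⁆ Module.End R M)
    (N : Multiset I) (m : M) :
    UniversalEnvelopingAlgebra.lift R (O.rep ρ) (O.monomial N) (Finsupp.single 0 m) =
      Finsupp.single N m := by
  induction hn : N.card generalizing N with
  | zero => rw [Multiset.card_eq_zero.1 hn, monomial_zero, map_one, Module.End.one_apply]
  | succ n ih =>
    rcases eq_zero_or_exists_cons N with rfl | ⟨j, N, rfl, hj⟩
    · simp at hn
    · rw [O.monomial_cons hj, map_mul, Module.End.mul_apply, ih N (by simpa using hn),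
        UniversalEnvelopingAlgebra.lift_ι_apply, rep_apply, O.act_z_single ρ hj]

end Monomial

variable {g I M : Type*} [LieRing g] [LieAlgebra ℂ g] {H : LieSubalgebra ℂ g}
  (O : OrderedComplement H I) [LinearOrder I] [AddCommGroup M] [Module ℂ M]
  (ρ : H →ₗ⁅ℂ⁆ Module.End ℂ M)

/-- The linear map from polynomials to the induced module given by ordered products. -/
def ofPoly : (Multiset I →₀ M) →ₗ[ℂ] InducedModule H ρ :=
  Finsupp.lsum ℂ fun N => (inducedRelations H ρ).mkQ.restrictScalars ℂ ∘ₗ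
    TensorProduct.mk ℂ (UniversalEnvelopingAlgebra ℂ g) M (O.monomial N)

theorem ofPoly_single (N : Multiset I) (m : M) :
    O.ofPoly ρ (Finsupp.single N m) = InducedModule.tmul H ρ (O.monomial N) m :=
  Finsupp.lsum_single _ _ _ _

theorem ofPoly_act_z {i : I} {N : Multiset I} (hi : ∀ a ∈ N, i ≤ a) (m : M) :
    O.ofPoly ρ (O.act ρ (O.z i) (Finsupp.single N m)) =
      UniversalEnvelopingAlgebra.ι ℂ (O.z i) • O.ofPoly ρ (Finsupp.single N m) := by
  rw [O.act_z_single ρ hi, ofPoly_single, ofPoly_single, InducedModule.smul_tmul,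
    O.monomial_cons hi]

theorem ofPoly_act_cons {j : I} {N : Multiset I} (hj : ∀ a ∈ N, j ≤ a)
    (hdeg : ∀ x, ∀ p ∈ degLE ℂ I M N.card,
      O.ofPoly ρ (O.act ρ x p) = UniversalEnvelopingAlgebra.ι ℂ x • O.ofPoly ρ p)
    {x : g} (hx : O.After (j ::ₘ N) x) (m : M) :
    O.ofPoly ρ (O.act ρ x (Finsupp.single (j ::ₘ N) m)) =
      UniversalEnvelopingAlgebra.ι ℂ x • O.ofPoly ρ (Finsupp.single (j ::ₘ N) m) := by
  have hN (y : g) := hdeg y _ (single_mem_degLE le_rfl m)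
  have hz : O.ofPoly ρ (O.act ρ (O.z j) (O.act ρ x (Finsupp.single N m))) =
      UniversalEnvelopingAlgebra.ι ℂ (O.z j) • O.ofPoly ρ (O.act ρ x (Finsupp.single N m)) :=
    O.act_single_mem_of_after ρ hj hx m
      (P := LinearMap.eqLocus (O.ofPoly ρ ∘ₗ O.act ρ (O.z j))
        (Algebra.lsmul ℂ ℂ _ (UniversalEnvelopingAlgebra.ι ℂ (O.z j)) ∘ₗ O.ofPoly ρ))
      (fun p hp => hdeg _ p hp) fun N' hN' => O.ofPoly_act_z ρ hN' m
  rw [O.act_single_cons ρ hj hx, map_add, hz, hN x, hN ⁅x, O.z j⁆, ← O.act_z_single ρ hj,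
    O.ofPoly_act_z ρ hj, LieHom.map_lie, LieRing.of_associative_ring_bracket, sub_smul, mul_smul,
    mul_smul, add_sub_cancel]

theorem ofPoly_act_single (N : Multiset I) (x : g) (m : M) :
    O.ofPoly ρ (O.act ρ x (Finsupp.single N m)) =
      UniversalEnvelopingAlgebra.ι ℂ x • O.ofPoly ρ (Finsupp.single N m) := by
  induction hn : N.card using Nat.strong_induction_on generalizing N x m with
  | _ n ih =>
  suffices O.ofPoly ρ ∘ₗ LinearMap.applyₗ (Finsupp.single N m) ∘ₗ O.act ρ =
      LinearMap.applyₗ (O.ofPoly ρ (Finsupp.single N m)) ∘ₗ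
        (Algebra.lsmul ℂ ℂ (InducedModule H ρ)).toLinearMap ∘ₗ
          (UniversalEnvelopingAlgebra.ι ℂ).toLinearMap from LinearMap.congr_fun this x
  refine O.linearMap_ext_after N (fun i hi => O.ofPoly_act_z ρ hi m) fun x hx => ?_
  change O.ofPoly ρ (O.act ρ x (Finsupp.single N m)) =
    UniversalEnvelopingAlgebra.ι ℂ x • O.ofPoly ρ (Finsupp.single N m)
  rcases eq_zero_or_exists_cons N with rfl | ⟨j, N, rfl, hj⟩
  · rw [O.act_single_zero ρ (O.after_zero.1 hx), ofPoly_single, ofPoly_single, monomial_zero,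
      InducedModule.smul_tmul, mul_one]
    exact (InducedModule.tmul_one_ι ⟨x, O.after_zero.1 hx⟩ m).symm
  · refine O.ofPoly_act_cons ρ hj (fun y => ?_) hx m
    refine degLE_le (P := LinearMap.eqLocus (O.ofPoly ρ ∘ₗ O.act ρ y)
      (Algebra.lsmul ℂ ℂ _ (UniversalEnvelopingAlgebra.ι ℂ y) ∘ₗ O.ofPoly ρ)) fun N' hN' m' => ?_
    exact ih _ (by rw [← hn, Multiset.card_cons]; omega) N' y m' rfl

theorem ofPoly_act (x : g) (p : Multiset I →₀ M) :
    O.ofPoly ρ (O.act ρ x p) = UniversalEnvelopingAlgebra.ι ℂ x • O.ofPoly ρ p := by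
  suffices O.ofPoly ρ ∘ₗ O.act ρ x =
      Algebra.lsmul ℂ ℂ _ (UniversalEnvelopingAlgebra.ι ℂ x) ∘ₗ O.ofPoly ρ from
    LinearMap.congr_fun this p
  exact Finsupp.lhom_ext fun N m => O.ofPoly_act_single ρ N x m

theorem ofPoly_lift_rep (u : UniversalEnvelopingAlgebra ℂ g) (p : Multiset I →₀ M) :
    O.ofPoly ρ (UniversalEnvelopingAlgebra.lift ℂ (O.rep ρ) u p) = u • O.ofPoly ρ p :=
  enveloping_intertwines (B := Algebra.lsmul ℂ ℂ (InducedModule H ρ))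
    (fun x p => by simpa [rep_apply] using O.ofPoly_act ρ x p) u p

/-- The linear map from the induced module to polynomials given by the action on constants. -/
def toPoly : InducedModule H ρ →ₗ[ℂ] (Multiset I →₀ M) :=
  InducedModule.lift (O.rep ρ) (f := Finsupp.lsingle 0) fun h m => (O.act_single_zero ρ h.2 m).symm

theorem toPoly_tmul (u : UniversalEnvelopingAlgebra ℂ g) (m : M) :
    O.toPoly ρ (InducedModule.tmul H ρ u m) =
      UniversalEnvelopingAlgebra.lift ℂ (O.rep ρ) u (Finsupp.single 0 m) :=
  InducedModule.lift_tmul _ _ u m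

/-- The relative Poincaré–Birkhoff–Witt theorem: as a vector space, `U(g) ⊗_{U(H)} M` is the space
of polynomials in an ordered complement of `H` with coefficients in `M`. -/
def pbwEquiv : (Multiset I →₀ M) ≃ₗ[ℂ] InducedModule H ρ :=
  .ofLinearMap (O.ofPoly ρ) (O.toPoly ρ)
    (InducedModule.linearMap_ext fun u m => by
      rw [LinearMap.comp_apply, toPoly_tmul, ofPoly_lift_rep, ofPoly_single, monomial_zero,
        InducedModule.smul_tmul, mul_one, LinearMap.id_apply])
    (Finsupp.lhom_ext fun N m => by
      rw [LinearMap.comp_apply, ofPoly_single, toPoly_tmul, lift_rep_monomial, LinearMap.id_apply])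

/-- The Poincaré–Birkhoff–Witt basis of a module induced from a one-dimensional representation. -/
def pbwBasis (ρ : H →ₗ⁅ℂ⁆ Module.End ℂ ℂ) : Module.Basis (Multiset I) ℂ (InducedModule H ρ) :=
  .ofRepr (O.pbwEquiv ρ).symm

theorem pbwBasis_apply (ρ : H →ₗ⁅ℂ⁆ Module.End ℂ ℂ) (N : Multiset I) :
    O.pbwBasis ρ N = O.monomial N • InducedModule.tmul H ρ 1 1 := by
  rw [InducedModule.smul_tmul, mul_one]
  exact O.ofPoly_single ρ N 1

end OrderedComplement

/-! ### Monomials with blocks of three factors -/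

section Word

variable {J : Type*} (p q r : J →₀ ℕ)

/-- The list in which `(i, 0)`, `(i, 1)`, `(i, 2)` occur `p i`, `q i`, `r i` times, in this
order. -/
def block (i : J) : List (J ×ₗ Fin 3) :=
  List.replicate (p i) (toLex (i, 0)) ++ List.replicate (q i) (toLex (i, 1)) ++
    List.replicate (r i) (toLex (i, 2))

variable {p q r} in
theorem fst_of_mem_block {i : J} {x : J ×ₗ Fin 3} (h : x ∈ block p q r i) : (ofLex x).1 = i := by
  simp only [block, List.mem_append, List.mem_replicate] at h
  rcases h with (⟨-, rfl⟩ | ⟨-, rfl⟩) | ⟨-, rfl⟩ <;> rfl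

variable [LinearOrder J]

/-- The sorted list in which `(i, 0)`, `(i, 1)`, `(i, 2)` occur `p i`, `q i`, `r i` times for all
`i`. -/
def word : List (J ×ₗ Fin 3) :=
  ((p.support ∪ q.support ∪ r.support).sort (· ≤ ·)).flatMap (block p q r)

theorem pairwise_block (i : J) : (block p q r i).Pairwise (· ≤ ·) := by
  simp only [block, List.pairwise_append, List.pairwise_replicate, List.mem_append,
    List.mem_replicate]
  refine ⟨⟨Or.inr le_rfl, Or.inr le_rfl, ?_⟩, Or.inr le_rfl, ?_⟩
  · rintro _ ⟨-, rfl⟩ _ ⟨-, rfl⟩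
    simp [Prod.Lex.toLex_le_toLex]
  · rintro _ (⟨-, rfl⟩ | ⟨-, rfl⟩) _ ⟨-, rfl⟩ <;> simp [Prod.Lex.toLex_le_toLex]

theorem pairwise_word : (word p q r).Pairwise (· ≤ ·) := by
  refine List.pairwise_flatMap.2 ⟨fun i _ => pairwise_block p q r i,
    (Finset.sortedLT_sort _).pairwise.imp fun {i j} hij x hx y hy => Prod.Lex.le_iff.2 (Or.inl ?_)⟩
  rwa [fst_of_mem_block hx, fst_of_mem_block hy]

theorem sort_word : (word p q r : Multiset (J ×ₗ Fin 3)).sort (· ≤ ·) = word p q r := by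
  rw [Multiset.coe_sort]
  exact List.mergeSort_eq_self _ (pairwise_word p q r)

theorem count_block (i j : J) (t : Fin 3) :
    (block p q r j : Multiset (J ×ₗ Fin 3)).count (toLex (i, t)) =
      if j = i then (![p, q, r] t) i else 0 := by
  simp only [block, ← Multiset.coe_add, Multiset.coe_replicate, Multiset.count_add,
    Multiset.count_replicate]
  by_cases h : j = i
  · subst h
    fin_cases t <;> simp
  · simp [h]

theorem count_word (i : J) (t : Fin 3) :
    (word p q r : Multiset (J ×ₗ Fin 3)).count (toLex (i, t)) = (![p, q, r] t) i := by
  rw [word, ← Multiset.coe_bind, Multiset.count_bind, Finset.sort_eq]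
  simp only [count_block]
  refine (Finset.sum_ite_eq' _ _ _).trans (ite_eq_left_iff.2 fun h => ?_)
  simp only [Finset.mem_union, Finsupp.mem_support_iff, not_or, not_not] at h
  fin_cases t <;> simp [h]

theorem bijective_word : Function.Bijective fun x : (J →₀ ℕ) × (J →₀ ℕ) × (J →₀ ℕ) =>
    (word x.1 x.2.1 x.2.2 : Multiset (J ×ₗ Fin 3)) := by
  constructor
  · rintro ⟨p, q, r⟩ ⟨p', q', r'⟩ h
    have hcount (t : Fin 3) : ![p, q, r] t = ![p', q', r'] t := Finsupp.ext fun i => by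
      rw [← count_word, ← count_word]
      exact congrArg (Multiset.count (toLex (i, t))) h
    simp only [Prod.mk.injEq]
    exact ⟨hcount 0, hcount 1, hcount 2⟩
  · intro N
    let e (t : Fin 3) : J →₀ ℕ := (Multiset.toFinsupp N).comapDomain (fun i => toLex (i, t))
      (fun i _ j _ h => by simpa using h)
    have he (t : Fin 3) (i : J) : e t i = N.count (toLex (i, t)) :=
      (Finsupp.comapDomain_apply _ _ _ _).trans (Multiset.toFinsupp_apply _ _)
    refine ⟨(e 0, e 1, e 2), Multiset.ext.2 fun x => ?_⟩
    obtain ⟨⟨i, t⟩, rfl⟩ := toLex.surjective x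
    refine (count_word _ _ _ i t).trans ?_
    fin_cases t <;> exact he _ i

end Word

namespace OrderedComplement

theorem monomial_word {R g J : Type*} [CommRing R] [LieRing g] [LieAlgebra R g]
    {H : LieSubalgebra R g} [LinearOrder J] (O : OrderedComplement H (J ×ₗ Fin 3))
    (p q r : J →₀ ℕ) :
    O.monomial (word p q r) = (((p.support ∪ q.support ∪ r.support).sort (· ≤ ·)).map fun i =>
      UniversalEnvelopingAlgebra.ι R (O.z (toLex (i, 0))) ^ p i *
      UniversalEnvelopingAlgebra.ι R (O.z (toLex (i, 1))) ^ q i *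
      UniversalEnvelopingAlgebra.ι R (O.z (toLex (i, 2))) ^ r i).prod := by
  rw [monomial, sort_word, word]
  simp [block, List.flatMap, List.prod_flatten, List.map_map, Function.comp_def, mul_assoc]

section TripleBasis

variable {g J : Type*} [LieRing g] [LieAlgebra ℂ g] {H : LieSubalgebra ℂ g} [LinearOrder J]
  (O : OrderedComplement H (J ×ₗ Fin 3)) (χ : H →ₗ⁅ℂ⁆ ℂ)

/-- The Poincaré–Birkhoff–Witt basis of the module induced from a character, indexed by the
exponents of the monomials. -/
def tripleBasis :
    Module.Basis ((J →₀ ℕ) × (J →₀ ℕ) × (J →₀ ℕ)) ℂ (InducedModule H (charRep H χ)) :=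
  (O.pbwBasis (charRep H χ)).reindex (Equiv.ofBijective _ bijective_word).symm

theorem tripleBasis_apply (x : (J →₀ ℕ) × (J →₀ ℕ) × (J →₀ ℕ)) :
    O.tripleBasis χ x =
      O.monomial (word x.1 x.2.1 x.2.2) • InducedModule.tmul H (charRep H χ) 1 1 := by
  rw [tripleBasis, Module.Basis.reindex_apply, Equiv.symm_symm, pbwBasis_apply]
  rfl

end TripleBasis

/-- The ordered complement with basis `z` given by coordinates which are only known to vanish on
`H`: if `z` and `H` span `g`, they vanish nowhere else. -/
def ofSup {R g I : Type*} [CommRing R] [LieRing g] [LieAlgebra R g] {H : LieSubalgebra R g}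
    (z : I → g) (coord : g →ₗ[R] I →₀ R) (coord_z : ∀ i, coord (z i) = Finsupp.single i 1)
    (le_ker : H.toSubmodule ≤ LinearMap.ker coord)
    (sup_eq_top : Submodule.span R (Set.range z) ⊔ H.toSubmodule = ⊤) :
    OrderedComplement H I where
  z := z
  coord := coord
  coord_z := coord_z
  coord_eq_zero_iff {x} := by
    refine ⟨fun hx => ?_, fun hx => le_ker hx⟩
    have hsup : x ∈ Submodule.span R (Set.range z) ⊔ H.toSubmodule := sup_eq_top ▸ Submodule.mem_top
    obtain ⟨s, hs, h, hh, rfl⟩ := Submodule.mem_sup.1 hsup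
    obtain ⟨v, rfl⟩ := Finsupp.mem_span_range_iff_exists_finsupp.1 hs
    have hv : v = 0 := by
      rw [map_add, LinearMap.mem_ker.1 (le_ker hh), add_zero] at hx
      simpa [map_finsuppSum, coord_z] using hx
    simpa [hv] using hh

end OrderedComplement

/-! ### The complement of `N` in affine `sl₂` -/

/-- The elements `e₋ᵢ₋₁`, `h₋ᵢ`, `f₋ᵢ`. -/
def affZ (x : ℕ ×ₗ Fin 3) : AffineSl2 :=
  ![loop sl2E (-(ofLex x).1 - 1), loop sl2H (-(ofLex x).1), loop sl2F (-(ofLex x).1)] (ofLex x).2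

/-- The entry of a matrix in `sl₂` as a linear functional. -/
def sl2Entry (i j : Fin 2) : Sl2 →ₗ[ℂ] ℂ :=
  Matrix.entryLinearMap ℂ ℂ i j ∘ₗ (LieAlgebra.SpecialLinear.sl (Fin 2) ℂ).toSubmodule.subtype

theorem sl2Entry_apply (i j : Fin 2) (x : Sl2) : sl2Entry i j x = x.1 i j := rfl

/-- The coordinates of `x ⊗ tⁿ` with respect to `affZ`, as a function of `x`. -/
def affCoordAt (n : ℤ) : Sl2 →ₗ[ℂ] (ℕ ×ₗ Fin 3) →₀ ℂ :=
  (sl2Entry 0 1).smulRight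
      (if n ≤ -1 then Finsupp.single (toLex ((-n - 1).toNat, 0)) 1 else 0) +
    (sl2Entry 0 0).smulRight
      (if n ≤ 0 then Finsupp.single (toLex ((-n).toNat, 1)) 1 else 0) +
    (sl2Entry 1 0).smulRight
      (if n ≤ 0 then Finsupp.single (toLex ((-n).toNat, 2)) 1 else 0)

/-- The coordinates with respect to `affZ` modulo `affN`. -/
def affCoord : AffineSl2 →ₗ[ℂ] (ℕ ×ₗ Fin 3) →₀ ℂ :=
  Finsupp.lsum ℂ affCoordAt ∘ₗ (LieAlgebra.LoopAlgebra.toFinsupp ℂ ℤ Sl2).toLinearMap ∘ₗ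
    LinearMap.fst ℂ _ _ ∘ₗ affOf.symm.toLinearMap

theorem affCoord_loop (x : Sl2) (n : ℤ) : affCoord (loop x n) = affCoordAt n x := by
  change Finsupp.lsum ℂ affCoordAt (LieAlgebra.LoopAlgebra.toFinsupp ℂ ℤ Sl2
    (AddMonoidAlgebra.single n 1 ⊗ₜ[ℂ] x)) = _
  rw [LieAlgebra.LoopAlgebra.toFinsupp_single_tmul, Finsupp.lsum_single]

theorem affCoord_loop_sl2E (n : ℤ) : affCoord (loop sl2E n) =
    if n ≤ -1 then Finsupp.single (toLex ((-n - 1).toNat, 0)) 1 else 0 := by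
  simp [affCoord_loop, affCoordAt, sl2Entry_apply, sl2E]

theorem affCoord_loop_sl2H (n : ℤ) : affCoord (loop sl2H n) =
    if n ≤ 0 then Finsupp.single (toLex ((-n).toNat, 1)) 1 else 0 := by
  simp [affCoord_loop, affCoordAt, sl2Entry_apply, sl2H]

theorem affCoord_loop_sl2F (n : ℤ) : affCoord (loop sl2F n) =
    if n ≤ 0 then Finsupp.single (toLex ((-n).toNat, 2)) 1 else 0 := by
  simp [affCoord_loop, affCoordAt, sl2Entry_apply, sl2F]

theorem affCoord_affK : affCoord affK = 0 := by
  simp [affCoord, affK]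

theorem affCoord_affZ (x : ℕ ×ₗ Fin 3) : affCoord (affZ x) = Finsupp.single x 1 := by
  obtain ⟨⟨i, t⟩, rfl⟩ := toLex.surjective x
  fin_cases t <;> simp [affZ, affCoord_loop_sl2E, affCoord_loop_sl2H, affCoord_loop_sl2F]

theorem affN_le_ker_affCoord : affN.toSubmodule ≤ LinearMap.ker affCoord := by
  refine Submodule.span_le.2 ?_
  rintro x (⟨n, rfl | rfl | rfl⟩ | rfl)
  · exact (affCoord_loop_sl2E n).trans (if_neg (by omega))
  · exact (affCoord_loop_sl2F _).trans (if_neg (by omega))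
  · exact (affCoord_loop_sl2H _).trans (if_neg (by omega))
  · exact affCoord_affK

theorem sl2_eq_add (x : Sl2) : x = x.1 0 1 • sl2E + x.1 0 0 • sl2H + x.1 1 0 • sl2F := by
  have htrace : x.1 0 0 + x.1 1 1 = 0 := by
    rw [← Matrix.trace_fin_two]
    exact x.2
  ext i j
  fin_cases i <;> fin_cases j <;> simp [sl2E, sl2H, sl2F]
  linear_combination htrace

theorem loop_add (x y : Sl2) (n : ℤ) : loop (x + y) n = loop x n + loop y n := by
  rw [loop, loop, loop, ← map_add, TensorProduct.tmul_add, Prod.mk_add_mk, add_zero]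

theorem eq_top_of_loop_mem {P : Submodule ℂ AffineSl2} (hloop : ∀ x n, loop x n ∈ P)
    (hK : affK ∈ P) : P = ⊤ := by
  suffices hfst : ∀ f : ℤ →₀ Sl2,
      affOf ((LieAlgebra.LoopAlgebra.toFinsupp ℂ ℤ Sl2).symm f, 0) ∈ P by
    refine P.eq_top_iff'.2 fun x => ?_
    obtain ⟨⟨y, c⟩, rfl⟩ := affOf.surjective x
    obtain ⟨f, rfl⟩ := (LieAlgebra.LoopAlgebra.toFinsupp ℂ ℤ Sl2).symm.surjective y
    convert P.add_mem (hfst f) (P.smul_mem c hK) using 1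
    rw [affK, ← map_smul, ← map_add]
    simp
  intro f
  induction f using Finsupp.induction_linear with
  | zero =>
    rw [map_zero]
    exact (map_zero affOf).symm ▸ P.zero_mem
  | add f f' hf hf' =>
    rw [map_add, ← add_zero (0 : ℂ), ← Prod.mk_add_mk, map_add]
    exact P.add_mem hf hf'
  | single n x =>
    rw [LieAlgebra.LoopAlgebra.toFinsupp_symm_single]
    exact hloop x n

theorem span_affZ_sup_affN : Submodule.span ℂ (Set.range affZ) ⊔ affN.toSubmodule = ⊤ := by
  set P := Submodule.span ℂ (Set.range affZ) ⊔ affN.toSubmodule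
  have hN {x : AffineSl2} (hx : x ∈ affGens) : x ∈ P :=
    Submodule.mem_sup_right (Submodule.subset_span hx)
  have hZ (i : ℕ) (t : Fin 3) : affZ (toLex (i, t)) ∈ P :=
    Submodule.mem_sup_left (Submodule.subset_span ⟨_, rfl⟩)
  have hE (n : ℤ) : loop sl2E n ∈ P := by
    rcases le_or_gt 0 n with h | h
    · obtain ⟨m, rfl⟩ := Int.eq_ofNat_of_zero_le h
      exact hN (Or.inl ⟨m, Or.inl rfl⟩)
    · obtain ⟨m, rfl⟩ : ∃ m : ℕ, n = -m - 1 := ⟨(-n - 1).toNat, by omega⟩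
      exact hZ m 0
  have hH (n : ℤ) : loop sl2H n ∈ P := by
    rcases le_or_gt n 0 with h | h
    · obtain ⟨m, rfl⟩ := Int.exists_eq_neg_ofNat h
      exact hZ m 1
    · obtain ⟨m, rfl⟩ := Int.eq_succ_of_zero_lt h
      exact hN (Or.inl ⟨m, Or.inr (Or.inr rfl)⟩)
  have hF (n : ℤ) : loop sl2F n ∈ P := by
    rcases le_or_gt n 0 with h | h
    · obtain ⟨m, rfl⟩ := Int.exists_eq_neg_ofNat h
      exact hZ m 2
    · obtain ⟨m, rfl⟩ := Int.eq_succ_of_zero_lt h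
      exact hN (Or.inl ⟨m, Or.inr (Or.inl rfl)⟩)
  refine eq_top_of_loop_mem (fun x n => ?_) (hN (Or.inr rfl))
  rw [sl2_eq_add x, loop_add, loop_add, loop_smul, loop_smul, loop_smul]
  exact P.add_mem (P.add_mem (P.smul_mem _ (hE n)) (P.smul_mem _ (hH n))) (P.smul_mem _ (hF n))

/-- The complement of `N` in affine `sl₂` with basis `e₋ᵢ₋₁`, `h₋ᵢ`, `f₋ᵢ`. -/
def affComplement : OrderedComplement affN (ℕ ×ₗ Fin 3) :=
  .ofSup affZ affCoord affCoord_affZ affN_le_ker_affCoord span_affZ_sup_affN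

/-! ### The complement of `N_𝓛` in the Virasoro algebra -/

/-- The elements `L₋₃ᵢ`, `L₋₃ᵢ₋₁`, `L₋₃ᵢ₋₂`. -/
def virZ (x : ℕ ×ₗ Fin 3) : Virasoro :=
  ![Virasoro.L (-3 * (ofLex x).1), Virasoro.L (-3 * (ofLex x).1 - 1),
    Virasoro.L (-3 * ((ofLex x).1 + 1) + 1)] (ofLex x).2

theorem virZ_toLex (i : ℕ) (t : Fin 3) :
    virZ (toLex (i, t)) = Virasoro.L (-(3 * i + t : ℤ)) := by
  fin_cases t <;> refine congrArg Virasoro.L ?_ <;> dsimp <;> ring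

theorem L_neg_eq_virZ (n : ℕ) : Virasoro.L (-n) = virZ (toLex (n / 3, Fin.ofNat 3 n)) := by
  rw [virZ_toLex, Fin.val_ofNat]
  congr 1
  omega

/-- The coordinates with respect to `virZ` modulo `virN`. -/
def virCoord : Virasoro →ₗ[ℂ] (ℕ ×ₗ Fin 3) →₀ ℂ :=
  Finsupp.linearCombination ℂ (fun n : ℤ => if n ≤ 0 then
    Finsupp.single (toLex ((-n).toNat / 3, Fin.ofNat 3 (-n).toNat)) 1 else 0) ∘ₗ
    LinearMap.fst ℂ _ _ ∘ₗ Virasoro.linearEquivProd.toLinearMap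

theorem virCoord_L (n : ℤ) : virCoord (Virasoro.L n) = if n ≤ 0 then
    Finsupp.single (toLex ((-n).toNat / 3, Fin.ofNat 3 (-n).toNat)) 1 else 0 := by
  change Finsupp.linearCombination ℂ _ (Finsupp.single n 1) = _
  rw [Finsupp.linearCombination_single, one_smul]

theorem virCoord_C : virCoord Virasoro.C = 0 := by
  rw [virCoord, LinearMap.comp_apply]
  exact map_zero _

theorem virCoord_virZ (x : ℕ ×ₗ Fin 3) : virCoord (virZ x) = Finsupp.single x 1 := by
  obtain ⟨⟨i, t⟩, rfl⟩ := toLex.surjective x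
  rw [virZ_toLex, virCoord_L, if_pos (by omega), neg_neg]
  congr 3
  · omega
  · ext
    simp only [Fin.val_ofNat]
    omega

theorem virN_le_ker_virCoord : virN.toSubmodule ≤ LinearMap.ker virCoord := by
  refine Submodule.span_le.2 ?_
  rintro x (⟨n, rfl⟩ | rfl)
  · exact (virCoord_L _).trans (if_neg (by omega))
  · exact virCoord_C

theorem eq_top_of_L_mem {P : Submodule ℂ Virasoro} (hL : ∀ n, Virasoro.L n ∈ P)
    (hC : Virasoro.C ∈ P) : P = ⊤ := by
  let Q : Submodule ℂ (ℤ →₀ ℂ) :=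
    P.comap (Virasoro.linearEquivProd.symm.toLinearMap ∘ₗ LinearMap.inl ℂ _ _)
  have hQ (f : ℤ →₀ ℂ) : f ∈ Q := by
    induction f using Finsupp.induction_linear with
    | zero => exact Q.zero_mem
    | add f f' hf hf' => exact Q.add_mem hf hf'
    | single n a =>
      rw [← mul_one a, ← smul_eq_mul, ← Finsupp.smul_single]
      exact Q.smul_mem a (hL n)
  refine P.eq_top_iff'.2 fun x => ?_
  obtain ⟨⟨f, c⟩, rfl⟩ := Virasoro.linearEquivProd.symm.surjective x
  have hcentral : Virasoro.linearEquivProd.symm (0, c) = c • Virasoro.C :=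
    Virasoro.ext (smul_zero c).symm (mul_one c).symm
  rw [← add_zero f, ← zero_add c, ← Prod.mk_add_mk, map_add, hcentral]
  exact P.add_mem (hQ f) (P.smul_mem c hC)

theorem span_virZ_sup_virN : Submodule.span ℂ (Set.range virZ) ⊔ virN.toSubmodule = ⊤ := by
  have hN {x : Virasoro} (hx : x ∈ virGens) :
      x ∈ Submodule.span ℂ (Set.range virZ) ⊔ virN.toSubmodule :=
    Submodule.mem_sup_right (Submodule.subset_span hx)
  refine eq_top_of_L_mem (fun n => ?_) (hN (Or.inr rfl))
  rcases le_or_gt n 0 with h | h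
  · obtain ⟨m, rfl⟩ := Int.exists_eq_neg_ofNat h
    exact Submodule.mem_sup_left (Submodule.subset_span ⟨_, (L_neg_eq_virZ m).symm⟩)
  · obtain ⟨m, rfl⟩ := Int.eq_succ_of_zero_lt h
    exact hN (Or.inl ⟨m, rfl⟩)

/-- The complement of `N_𝓛` in the Virasoro algebra with basis `L₋ₙ`, `n ≥ 0`. -/
def virComplement : OrderedComplement virN (ℕ ×ₗ Fin 3) :=
  .ofSup virZ virCoord virCoord_virZ virN_le_ker_virCoord span_virZ_sup_virN

/-! ### The two bases -/

section Bases

variable (κ l m : ℕ →₀ ℕ)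

/-- The ordered product `∏_{i ≥ 0} e_{-i-1}^{κ i} h_{-i}^{l i} f_{-i}^{m i}` in `U(ŝl₂)`. -/
def affMonomial : UniversalEnvelopingAlgebra ℂ AffineSl2 :=
  (((κ.support ∪ l.support ∪ m.support).sort (· ≤ ·)).map fun i : ℕ =>
    uLoop sl2E (-i - 1) ^ κ i * uLoop sl2H (-i) ^ l i * uLoop sl2F (-i) ^ m i).prod

/-- The ordered product `∏_{i ≥ 0} L_{-3i}^{l i} L_{-3i-1}^{m i} L_{-3(i+1)+1}^{κ i}` in `U(𝓛)`. -/
def virMonomial : UniversalEnvelopingAlgebra ℂ Virasoro :=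
  (((κ.support ∪ l.support ∪ m.support).sort (· ≤ ·)).map fun i : ℕ =>
    uL (-3 * i) ^ l i * uL (-3 * i - 1) ^ m i * uL (-3 * (i + 1) + 1) ^ κ i).prod

theorem monomial_affComplement_word : affComplement.monomial (word κ l m) = affMonomial κ l m :=
  affComplement.monomial_word κ l m

theorem monomial_virComplement_word : virComplement.monomial (word l m κ) = virMonomial κ l m := by
  rw [OrderedComplement.monomial_word, virMonomial, Finset.union_assoc κ.support,
    Finset.union_comm κ.support]
  rfl

/-- The basis of the module over affine `sl₂` induced from a character of `N`. -/
def affBasis (χ : affN →ₗ⁅ℂ⁆ ℂ) : Module.Basis ((ℕ →₀ ℕ) × (ℕ →₀ ℕ) × (ℕ →₀ ℕ)) ℂ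
    (InducedModule affN (charRep affN χ)) :=
  affComplement.tripleBasis χ

theorem affBasis_apply (χ : affN →ₗ⁅ℂ⁆ ℂ) : affBasis χ (κ, l, m) =
    affMonomial κ l m • InducedModule.tmul affN (charRep affN χ) 1 1 := by
  rw [affBasis, OrderedComplement.tripleBasis_apply, monomial_affComplement_word]

/-- The basis of the Virasoro module induced from a character of `N_𝓛`, with the exponents listed in
the order `κ`, `l`, `m` in which they occur in `affBasis`. -/
def virBasis (η : virN →ₗ⁅ℂ⁆ ℂ) : Module.Basis ((ℕ →₀ ℕ) × (ℕ →₀ ℕ) × (ℕ →₀ ℕ)) ℂ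
    (InducedModule virN (charRep virN η)) :=
  (virComplement.tripleBasis η).reindex ((Equiv.prodAssoc _ _ _).symm.trans (Equiv.prodComm _ _))

theorem virBasis_apply (η : virN →ₗ⁅ℂ⁆ ℂ) : virBasis η (κ, l, m) =
    virMonomial κ l m • InducedModule.tmul virN (charRep virN η) 1 1 := by
  rw [virBasis, Module.Basis.reindex_apply, OrderedComplement.tripleBasis_apply,
    ← monomial_virComplement_word]
  rfl

end Bases

theorem exists_unique_bijective_of_bases {R V W J : Type*} [CommSemiring R] [AddCommMonoid V]
    [Module R V] [AddCommMonoid W] [Module R W] (B : Module.Basis J R V)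
    (B' : Module.Basis J R W) :
    ∃ φ : V →ₗ[R] W, (∀ j, φ (B j) = B' j) ∧
      (∀ ψ : V →ₗ[R] W, (∀ j, ψ (B j) = B' j) → ψ = φ) ∧ Function.Bijective φ := by
  have hequiv (j : J) : B.equiv B' (Equiv.refl J) (B j) = B' j := B.equiv_apply j B' _
  exact ⟨(B.equiv B' (Equiv.refl J)).toLinearMap, hequiv,
    fun ψ hψ => B.ext fun j => (hψ j).trans (hequiv j).symm, (B.equiv B' (Equiv.refl J)).bijective⟩

end WhittakerIso

attribute [local instance 100] LieRing.ofAssociativeRing in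
open WhittakerIso in
theorem mainTheorem13_general (χ : affN →ₗ⁅ℂ⁆ ℂ) (η : virN →ₗ⁅ℂ⁆ ℂ) :
    (LinearIndependent ℂ (fun p : (ℕ →₀ ℕ) × (ℕ →₀ ℕ) × (ℕ →₀ ℕ) =>
        affMonomial p.1 p.2.1 p.2.2 • InducedModule.tmul affN (charRep affN χ) 1 1) ∧
      Submodule.span ℂ (Set.range (fun p : (ℕ →₀ ℕ) × (ℕ →₀ ℕ) × (ℕ →₀ ℕ) =>
        affMonomial p.1 p.2.1 p.2.2 • InducedModule.tmul affN (charRep affN χ) 1 1)) = ⊤) ∧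
    ∃ φ : InducedModule affN (charRep affN χ) →ₗ[ℂ] InducedModule virN (charRep virN η),
      (∀ κ l m : ℕ →₀ ℕ, φ (affMonomial κ l m • InducedModule.tmul affN (charRep affN χ) 1 1) =
        virMonomial κ l m • InducedModule.tmul virN (charRep virN η) 1 1) ∧
      (∀ ψ : InducedModule affN (charRep affN χ) →ₗ[ℂ] InducedModule virN (charRep virN η),
        (∀ κ l m : ℕ →₀ ℕ, ψ (affMonomial κ l m • InducedModule.tmul affN (charRep affN χ) 1 1) =
          virMonomial κ l m • InducedModule.tmul virN (charRep virN η) 1 1) → ψ = φ) ∧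
      Function.Bijective φ := by
  have hbasis : (fun p : (ℕ →₀ ℕ) × (ℕ →₀ ℕ) × (ℕ →₀ ℕ) => affMonomial p.1 p.2.1 p.2.2 •
      InducedModule.tmul affN (charRep affN χ) 1 1) = affBasis χ :=
    funext fun p => (affBasis_apply p.1 p.2.1 p.2.2 χ).symm
  rw [hbasis]
  refine ⟨⟨(affBasis χ).linearIndependent, (affBasis χ).span_eq⟩, ?_⟩
  simpa only [Prod.forall, affBasis_apply, virBasis_apply] using
    exists_unique_bijective_of_bases (affBasis χ) (virBasis η)

end

/-- The monomials in the `e₋ᵢ₋₁, h₋ᵢ, f₋ᵢ` applied to the Whittaker vector form a basis of the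
affine Whittaker module, and the unique linear map given on this basis by `affPBW ↦ virPBW` is an
isomorphism. -/
theorem mainTheorem13 (k c lam mu a b : ℂ) (hlam : lam ≠ 0) (hmu : mu ≠ 0)
    (hab : (a, b) ≠ (0, 0)) :
    (LinearIndependent ℂ (fun p : (ℕ →₀ ℕ) × (ℕ →₀ ℕ) × (ℕ →₀ ℕ) =>
        WhittakerIso.affPBW k lam mu p.1 p.2.1 p.2.2) ∧
      Submodule.span ℂ (Set.range (fun p : (ℕ →₀ ℕ) × (ℕ →₀ ℕ) × (ℕ →₀ ℕ) =>
        WhittakerIso.affPBW k lam mu p.1 p.2.1 p.2.2)) = ⊤) ∧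
    ∃ φ : WhittakerIso.WhAff k lam mu →ₗ[ℂ] WhittakerIso.WhVir c a b,
      (∀ κ l m : ℕ →₀ ℕ,
        φ (WhittakerIso.affPBW k lam mu κ l m) = WhittakerIso.virPBW c a b κ l m) ∧
      (∀ ψ : WhittakerIso.WhAff k lam mu →ₗ[ℂ] WhittakerIso.WhVir c a b,
        (∀ κ l m : ℕ →₀ ℕ,
          ψ (WhittakerIso.affPBW k lam mu κ l m) = WhittakerIso.virPBW c a b κ l m) → ψ = φ) ∧
      Function.Bijective φ :=
  mainTheorem13_general (WhittakerIso.affChar k lam mu) (WhittakerIso.virChar c a b)
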